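/- Let $n\ge 2$ and let $\rho:\mathbb{R}^n\to\mathbb{R}$ be a measurable function with compact support such that $0\le\rho\le 1$ almost everywhere and $\rho$ is nonzero on a set of positive Lebesgue measure. Here $\operatorname{supp}\rho$ denotes the (closed) support of the measure $\rho(\zeta)\,d\zeta$. Let $$E_\rho(x)=\exp\left[-\frac{2}{\omega_n}\int_{\mathbb{R}^n}\frac{\rho(\zeta)\,d\zeta}{|x-\zeta|^{n}}\right]$$ be the exponential transform of $\rho$, where $\omega_n$ is the $(n-1)$-dimensional measure of the unit sphere in $\mathbb{R}^n$. Then the function $$\begin{cases}\ln\bigl(1-E_\rho(x)\bigr), & \text{if } n=2,\\[4pt] \dfrac{1}{n-2}\bigl(1-E_\rho(x)\bigr)^{(n-2)/n}, & \text{if } n\ge 3,\end{cases}$$ is subharmonic in $\mathbb{R}^n\setminus\operatorname{supp}\rho$. (A function $u$ on an open set $\Omega$ is subharmonic if it is upper semicontinuous and, for every compact $K\subset\Omega$ and every function $h$ continuous on $K$ and harmonic in the interior of $K$, $u\le h$ on $\partial K$ implies $u\le h$ on $K$.) -/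

import Mathlib

open MeasureTheory

noncomputable section

namespace ExpTransform

/-- `u` is subharmonic on the open set `Ω`: it is upper semicontinuous there and it is dominated, on
every compact `K ⊆ Ω`, by each function that is continuous on `K`, harmonic in the interior of `K`
and at least `u` on the boundary of `K`. -/
def SubharmonicOn {n : ℕ} (u : EuclideanSpace ℝ (Fin n) → ℝ)
    (Ω : Set (EuclideanSpace ℝ (Fin n))) : Prop :=
  UpperSemicontinuousOn u Ω ∧
    ∀ K : Set (EuclideanSpace ℝ (Fin n)), IsCompact K → K ⊆ Ω →
      ∀ h : EuclideanSpace ℝ (Fin n) → ℝ, ContinuousOn h K →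
        InnerProductSpace.HarmonicOnNhd h (interior K) →
        (∀ x ∈ frontier K, u x ≤ h x) → ∀ x ∈ K, u x ≤ h x

/-- The support of a density `ρ ≥ 0`, i.e. the support of the measure `ρ dx`. -/
def densitySupport {n : ℕ} (ρ : EuclideanSpace ℝ (Fin n) → ℝ) :
    Set (EuclideanSpace ℝ (Fin n)) :=
  (volume.withDensity fun x => ENNReal.ofReal (ρ x)).support

/-- A density function: measurable, with values in `[0, 1]`, and compactly supported. As a density
is only relevant up to null sets, everything is required almost everywhere. -/
structure IsDensity {n : ℕ} (ρ : EuclideanSpace ℝ (Fin n) → ℝ) : Prop where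
  aemeasurable : AEMeasurable ρ volume
  nonneg : ∀ᵐ x, 0 ≤ ρ x
  le_one : ∀ᵐ x, ρ x ≤ 1
  isCompact_support : IsCompact (densitySupport ρ)

/-- `ω_n`, the `(n - 1)`-dimensional measure of the unit sphere of `ℝⁿ`. -/
def sphereArea (n : ℕ) : ℝ :=
  (volume : Measure (EuclideanSpace ℝ (Fin n))).toSphere.real Set.univ

open Classical in
/-- The exponential transform `E_ρ(x) = exp (-(2 / ω_n) ∫ ρ(ζ) / |x - ζ| ^ n dζ)`, with value
`exp (-∞) = 0` where the integral of this nonnegative function diverges. -/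
def expTransform {n : ℕ} (ρ : EuclideanSpace ℝ (Fin n) → ℝ)
    (x : EuclideanSpace ℝ (Fin n)) : ℝ :=
  if Integrable (fun ζ => ρ ζ / ‖x - ζ‖ ^ n) volume then
    Real.exp (-(2 / sphereArea n) * ∫ ζ, ρ ζ / ‖x - ζ‖ ^ n)
  else 0

end ExpTransform

end

open MeasureTheory

noncomputable section

namespace ExpTransform

open Set Filter Topology Metric
open scoped Pointwise

variable {n : ℕ}

/-- `φ` is differentiable near `t`, with derivative `a` at `t`, and its derivative has derivative
`b` at `t`. -/
def HasDeriv2At (φ : ℝ → ℝ) (a b t : ℝ) : Prop :=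
  ∃ g : ℝ → ℝ, (∀ᶠ s in 𝓝 t, HasDerivAt φ (g s) s) ∧ g t = a ∧ HasDerivAt g b t

namespace HasDeriv2At

variable {φ ψ : ℝ → ℝ} {a b a' b' t : ℝ}

theorem hasDerivAt (h : HasDeriv2At φ a b t) : HasDerivAt φ a t := by
  obtain ⟨g, hg, rfl, -⟩ := h
  exact hg.self_of_nhds

theorem congr_coeff (h : HasDeriv2At φ a b t) (ha : a = a') (hb : b = b') :
    HasDeriv2At φ a' b' t := ha ▸ hb ▸ h

theorem sub (h : HasDeriv2At φ a b t) (h' : HasDeriv2At ψ a' b' t) :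
    HasDeriv2At (fun s => φ s - ψ s) (a - a') (b - b') t := by
  obtain ⟨g, hg, rfl, hb⟩ := h
  obtain ⟨g', hg', rfl, hb'⟩ := h'
  refine ⟨fun s => g s - g' s, ?_, rfl, hb.sub hb'⟩
  filter_upwards [hg, hg'] with s h1 h2 using h1.sub h2

theorem add (h : HasDeriv2At φ a b t) (h' : HasDeriv2At ψ a' b' t) :
    HasDeriv2At (fun s => φ s + ψ s) (a + a') (b + b') t := by
  obtain ⟨g, hg, rfl, hb⟩ := h
  obtain ⟨g', hg', rfl, hb'⟩ := h'
  refine ⟨fun s => g s + g' s, ?_, rfl, hb.add hb'⟩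
  filter_upwards [hg, hg'] with s h1 h2 using h1.add h2

theorem mul (h : HasDeriv2At φ a b t) (h' : HasDeriv2At ψ a' b' t) :
    HasDeriv2At (fun s => φ s * ψ s) (a * ψ t + φ t * a')
      (b * ψ t + 2 * (a * a') + φ t * b') t := by
  have ha := h.hasDerivAt
  have ha' := h'.hasDerivAt
  obtain ⟨g, hg, rfl, hb⟩ := h
  obtain ⟨g', hg', rfl, hb'⟩ := h'
  refine ⟨fun s => g s * ψ s + φ s * g' s, ?_, rfl, ?_⟩
  · filter_upwards [hg, hg'] with s h1 h2 using h1.mul h2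
  · exact ((hb.mul ha').add (ha.mul hb')).congr_deriv (by ring)

theorem const (c t : ℝ) : HasDeriv2At (fun _ => c) 0 0 t :=
  ⟨fun _ => 0, .of_forall fun s => hasDerivAt_const s c, rfl, hasDerivAt_const t 0⟩

theorem const_mul (c : ℝ) (h : HasDeriv2At φ a b t) :
    HasDeriv2At (fun s => c * φ s) (c * a) (c * b) t :=
  ((const c t).mul h).congr_coeff (by ring) (by ring)

theorem comp {G G' : ℝ → ℝ} {c : ℝ} (hG : ∀ᶠ v in 𝓝 (φ t), HasDerivAt G (G' v) v)
    (hG' : HasDerivAt G' c (φ t)) (h : HasDeriv2At φ a b t) :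
    HasDeriv2At (fun s => G (φ s)) (G' (φ t) * a) (c * a ^ 2 + G' (φ t) * b) t := by
  have ha := h.hasDerivAt
  obtain ⟨g, hg, rfl, hb⟩ := h
  refine ⟨fun s => G' (φ s) * g s, ?_, rfl, ?_⟩
  · filter_upwards [hg, ha.continuousAt.eventually hG] with s h1 h2
    exact h2.comp s h1
  · exact ((hG'.comp t ha).mul hb).congr_deriv (by simp only [Function.comp]; ring)

/-- The second derivative test. -/
theorem nonpos_of_isLocalMax (h : HasDeriv2At φ a b t) (hmax : IsLocalMax φ t) : b ≤ 0 := by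
  by_contra! hb
  have ha := h.hasDerivAt
  obtain ⟨g, hg, rfl, hgb⟩ := h
  have hdg : deriv φ =ᶠ[𝓝 t] g := hg.mono fun s hs => hs.deriv
  have hmin : IsLocalMin φ t := by
    refine isLocalMin_of_deriv_deriv_pos ?_ ?_ ha.continuousAt
    · rwa [hdg.deriv_eq, hgb.deriv]
    · exact hmax.deriv_eq_zero
  have hc : φ =ᶠ[𝓝 t] fun _ => φ t := by
    filter_upwards [hmax, hmin] with s h1 h2 using le_antisymm h1 h2
  have h0 : g =ᶠ[𝓝 t] fun _ => 0 := by
    filter_upwards [hdg, hc.deriv] with s h1 h2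
    rw [← h1, h2, deriv_const]
  have := (hgb.congr_of_eventuallyEq h0.symm).unique (hasDerivAt_const t 0)
  exact hb.ne' this

end HasDeriv2At

/-- The `i`-th vector of the standard basis. -/
abbrev stdVec (i : Fin n) : EuclideanSpace ℝ (Fin n) := EuclideanSpace.single i 1

theorem hasDeriv2At_norm_sq (x e : EuclideanSpace ℝ (Fin n)) :
    HasDeriv2At (fun s => ‖x + s • e‖ ^ 2) (2 * inner ℝ x e) (2 * ‖e‖ ^ 2) 0 := by
  have key : ∀ s : ℝ, ‖x + s • e‖ ^ 2 = ‖x‖ ^ 2 + (2 * inner ℝ x e * s + ‖e‖ ^ 2 * s ^ 2) := by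
    intro s
    rw [norm_add_sq_real, inner_smul_right, norm_smul, mul_pow, Real.norm_eq_abs, sq_abs]
    ring
  refine ⟨fun s => 2 * inner ℝ x e + 2 * ‖e‖ ^ 2 * s, .of_forall fun s => ?_, by simp, ?_⟩
  · simp_rw [key]
    have := (((hasDerivAt_id s).const_mul (2 * inner ℝ x e)).add
      (((hasDerivAt_id s).pow 2).const_mul (‖e‖ ^ 2))).const_add (‖x‖ ^ 2)
    exact this.congr_deriv (by simp; ring)
  · simpa using ((hasDerivAt_id (0 : ℝ)).const_mul (2 * ‖e‖ ^ 2)).const_add (2 * inner ℝ x e)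

theorem hasDeriv2At_of_contDiffAt {h : EuclideanSpace ℝ (Fin n) → ℝ}
    {x : EuclideanSpace ℝ (Fin n)} (hh : ContDiffAt ℝ 2 h x) (e : EuclideanSpace ℝ (Fin n)) :
    HasDeriv2At (fun s => h (x + s • e)) (fderiv ℝ h x e) (iteratedFDeriv ℝ 2 h x ![e, e]) 0 := by
  have hl : ∀ s : ℝ, HasDerivAt (fun s : ℝ => x + s • e) e s := fun s => by
    simpa using ((hasDerivAt_id s).smul_const e).const_add x
  have hx : Tendsto (fun s : ℝ => x + s • e) (𝓝 0) (𝓝 x) := by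
    simpa using (hl 0).continuousAt.tendsto
  have hd : ∀ᶠ y in 𝓝 x, DifferentiableAt ℝ h y :=
    (hh.eventually (by simp)).mono fun y hy => hy.differentiableAt (by simp)
  refine ⟨fun s => fderiv ℝ h (x + s • e) e, ?_, by simp, ?_⟩
  · filter_upwards [hx.eventually hd] with s hs
    have := hs.hasFDerivAt.comp_hasDerivAt s (hl s)
    exact this
  · have h2 : DifferentiableAt ℝ (fderiv ℝ h) (x + (0 : ℝ) • e) := by
      simpa using (hh.fderiv_right (m := 1) (by norm_num)).differentiableAt (by simp)
    have h3 := h2.hasFDerivAt.comp_hasDerivAt (0 : ℝ) (hl 0)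
    have h4 := h3.clm_apply (hasDerivAt_const (0 : ℝ) e)
    refine h4.congr_deriv ?_
    simp [iteratedFDeriv_two_apply]

/-- The weak maximum principle. -/
theorem nonpos_of_sum_deriv2_nonneg (hn : 0 < n) {w : EuclideanSpace ℝ (Fin n) → ℝ}
    {K : Set (EuclideanSpace ℝ (Fin n))} (hK : IsCompact K) (hw : ContinuousOn w K)
    (hL : ∀ x ∈ interior K, ∃ a b : Fin n → ℝ,
      (∀ i, HasDeriv2At (fun s => w (x + s • stdVec i)) (a i) (b i) 0) ∧ 0 ≤ ∑ i, b i)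
    (hb : ∀ x ∈ frontier K, w x ≤ 0) : ∀ x ∈ K, w x ≤ 0 := by
  obtain ⟨R, hR⟩ : ∃ R, ∀ x ∈ K, ‖x‖ ≤ R := hK.isBounded.exists_norm_le
  intro x hx
  have main : ∀ ε > 0, w x ≤ ε * R ^ 2 := by
    intro ε hε
    obtain ⟨x₀, hx₀, hmax⟩ := hK.exists_isMaxOn (f := fun y => w y + ε * ‖y‖ ^ 2) ⟨x, hx⟩
      (hw.add (by fun_prop))
    have hxle := hmax hx
    simp only [mem_ofPred_eq] at hxle
    by_cases hint : x₀ ∈ interior K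
    · exfalso
      obtain ⟨a, b, hab, hsum⟩ := hL x₀ hint
      have hloc : IsLocalMax (fun y => w y + ε * ‖y‖ ^ 2) x₀ :=
        hmax.isLocalMax (mem_interior_iff_mem_nhds.1 hint)
      have hi : ∀ i, b i + ε * 2 ≤ 0 := by
        intro i
        have h2 := (hab i).add ((hasDeriv2At_norm_sq x₀ (stdVec i)).const_mul ε)
        have hc : Tendsto (fun s : ℝ => x₀ + s • stdVec i) (𝓝 0) (𝓝 x₀) := by
          have : Continuous (fun s : ℝ => x₀ + s • stdVec i) := by fun_prop
          simpa using this.tendsto 0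
        have := h2.nonpos_of_isLocalMax (by
          have := hc.eventually hloc
          filter_upwards [this] with s hs
          simpa using hs)
        simpa using this
      have hs : ∑ i : Fin n, (b i + ε * 2) ≤ 0 := Finset.sum_nonpos fun i _ => hi i
      rw [Finset.sum_add_distrib] at hs
      simp only [Finset.sum_const, Finset.card_univ, Fintype.card_fin, nsmul_eq_mul] at hs
      have : (0 : ℝ) < n * (ε * 2) := by positivity
      linarith
    · have hfr : x₀ ∈ frontier K := ⟨subset_closure hx₀, hint⟩
      have h1 := hb x₀ hfr
      have h2 : ε * ‖x₀‖ ^ 2 ≤ ε * R ^ 2 := by gcongr; exact hR x₀ hx₀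
      have h3 : 0 ≤ ε * ‖x‖ ^ 2 := by positivity
      linarith
  by_contra! hpos
  have h1 := main (w x / (2 * (R ^ 2 + 1))) (by positivity)
  have h2 : w x / (2 * (R ^ 2 + 1)) * R ^ 2 < w x := by
    rw [div_mul_eq_mul_div, div_lt_iff₀ (by positivity)]
    nlinarith [sq_nonneg R]
  linarith

/-- A continuous function whose second derivatives along the standard basis have a nonnegative sum
is subharmonic. -/
theorem subharmonicOn_of_sum_deriv2_nonneg (hn : 0 < n) {u : EuclideanSpace ℝ (Fin n) → ℝ}
    {Ω : Set (EuclideanSpace ℝ (Fin n))} (hu : ContinuousOn u Ω)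
    (hL : ∀ x ∈ Ω, ∃ a b : Fin n → ℝ,
      (∀ i, HasDeriv2At (fun s => u (x + s • stdVec i)) (a i) (b i) 0) ∧ 0 ≤ ∑ i, b i) :
    SubharmonicOn u Ω := by
  refine ⟨hu.upperSemicontinuousOn, fun K hK hKΩ h hh hharm hle x hx => ?_⟩
  refine sub_nonpos.1 (nonpos_of_sum_deriv2_nonneg hn (w := fun y => u y - h y) hK
    ((hu.mono hKΩ).sub hh) (fun y hy => ?_) (fun y hy => sub_nonpos.2 (hle y hy)) x hx)
  obtain ⟨a, b, hab, hsum⟩ := hL y (hKΩ (interior_subset hy))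
  obtain ⟨hc, hΔ⟩ := hharm y hy
  refine ⟨_, _, fun i => (hab i).sub (hasDeriv2At_of_contDiffAt hc (stdVec i)), ?_⟩
  have h0 : ∑ i, iteratedFDeriv ℝ 2 h y ![stdVec i, stdVec i] = 0 := by
    have := hΔ.self_of_nhds
    rw [InnerProductSpace.laplacian_eq_iteratedFDeriv_orthonormalBasis h
      (EuclideanSpace.basisFun (Fin n) ℝ)] at this
    simpa using this
  rw [Finset.sum_sub_distrib, h0, sub_zero]
  exact hsum

theorem hasDerivAt_norm_line {y e : EuclideanSpace ℝ (Fin n)} {s : ℝ} (h : y + s • e ≠ 0) :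
    HasDerivAt (fun s : ℝ => ‖y + s • e‖) (inner ℝ (y + s • e) e / ‖y + s • e‖) s := by
  have hl : HasDerivAt (fun s : ℝ => y + s • e) e s := by
    simpa using ((hasDerivAt_id s).smul_const e).const_add y
  have h0 : ‖y + s • e‖ ≠ 0 := norm_ne_zero_iff.2 h
  have h2 := hl.norm_sq.sqrt (pow_ne_zero 2 h0)
  simp only [Real.sqrt_sq (norm_nonneg _)] at h2
  refine h2.congr_deriv ?_
  field_simp

/-- The derivative of a power of the distance along a line. -/
theorem hasDerivAt_kernel (m : ℕ) {y e : EuclideanSpace ℝ (Fin n)} {s : ℝ} (h : y + s • e ≠ 0) :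
    HasDerivAt (fun s : ℝ => (‖y + s • e‖ ^ m)⁻¹)
      (-(m * inner ℝ (y + s • e) e * (‖y + s • e‖ ^ (m + 2))⁻¹)) s := by
  have h0 : ‖y + s • e‖ ≠ 0 := norm_ne_zero_iff.2 h
  have := ((hasDerivAt_norm_line h).pow m).inv (pow_ne_zero m h0)
  refine this.congr_deriv ?_
  rcases m with _ | k
  · simp
  · simp only [Nat.add_sub_cancel, Pi.pow_apply]
    field_simp
    ring

/-- The second derivative of a power of the distance along a line. -/
theorem hasDerivAt_kernel_deriv (m : ℕ) {y e : EuclideanSpace ℝ (Fin n)} {s : ℝ}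
    (he : ‖e‖ = 1) (h : y + s • e ≠ 0) :
    HasDerivAt (fun s : ℝ => -(m * inner ℝ (y + s • e) e * (‖y + s • e‖ ^ (m + 2))⁻¹))
      (-(m * ((‖y + s • e‖ ^ (m + 2))⁻¹ -
        (m + 2) * inner ℝ (y + s • e) e ^ 2 * (‖y + s • e‖ ^ (m + 4))⁻¹))) s := by
  have hl : HasDerivAt (fun s : ℝ => y + s • e) e s := by
    simpa using ((hasDerivAt_id s).smul_const e).const_add y
  have hi : HasDerivAt (fun s : ℝ => inner ℝ (y + s • e) e) 1 s := by
    have := hl.inner ℝ (hasDerivAt_const s e)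
    simpa [he] using this
  have := ((hi.const_mul (m : ℝ)).mul (hasDerivAt_kernel (m + 2) h)).neg
  refine this.congr_deriv ?_
  push_cast
  ring

theorem inv_pow_norm_le {d : ℝ} (hd : 0 < d) (m : ℕ) {y : EuclideanSpace ℝ (Fin n)}
    (h : d ≤ ‖y‖) : (‖y‖ ^ m)⁻¹ ≤ (d ^ m)⁻¹ := by
  gcongr

theorem abs_kernel_deriv_le {d : ℝ} (hd : 0 < d) (m : ℕ) {y e : EuclideanSpace ℝ (Fin n)}
    (he : ‖e‖ = 1) (h : d ≤ ‖y‖) :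
    ‖-(m * inner ℝ y e * (‖y‖ ^ (m + 2))⁻¹)‖ ≤ m * (d ^ (m + 1))⁻¹ := by
  have hy : 0 < ‖y‖ := hd.trans_le h
  have h1 : |inner ℝ y e| ≤ ‖y‖ := by simpa [he] using abs_real_inner_le_norm y e
  rw [norm_neg, Real.norm_eq_abs, abs_mul, abs_mul, Nat.abs_cast,
    abs_of_pos (inv_pos.2 (pow_pos hy _))]
  calc m * |inner ℝ y e| * (‖y‖ ^ (m + 2))⁻¹ ≤ m * ‖y‖ * (‖y‖ ^ (m + 2))⁻¹ := by gcongr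
    _ = m * (‖y‖ ^ (m + 1))⁻¹ := by field_simp; ring
    _ ≤ _ := by gcongr

theorem abs_kernel_deriv2_le {d : ℝ} (hd : 0 < d) (m : ℕ) {y e : EuclideanSpace ℝ (Fin n)}
    (he : ‖e‖ = 1) (h : d ≤ ‖y‖) :
    ‖-(m * ((‖y‖ ^ (m + 2))⁻¹ - (m + 2) * inner ℝ y e ^ 2 * (‖y‖ ^ (m + 4))⁻¹))‖ ≤
      m * ((m + 3) * (d ^ (m + 2))⁻¹) := by
  have hy : 0 < ‖y‖ := hd.trans_le h
  have h1 : |inner ℝ y e| ≤ ‖y‖ := by simpa [he] using abs_real_inner_le_norm y e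
  have h2 : inner ℝ y e ^ 2 ≤ ‖y‖ ^ 2 := sq_le_sq' (abs_le.1 h1).1 (abs_le.1 h1).2
  rw [norm_neg, Real.norm_eq_abs, abs_mul, Nat.abs_cast]
  gcongr
  calc |(‖y‖ ^ (m + 2))⁻¹ - (m + 2) * inner ℝ y e ^ 2 * (‖y‖ ^ (m + 4))⁻¹|
      ≤ |(‖y‖ ^ (m + 2))⁻¹| + |(m + 2) * inner ℝ y e ^ 2 * (‖y‖ ^ (m + 4))⁻¹| := abs_sub _ _
    _ = (‖y‖ ^ (m + 2))⁻¹ + (m + 2) * inner ℝ y e ^ 2 * (‖y‖ ^ (m + 4))⁻¹ := by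
      rw [abs_of_nonneg, abs_of_nonneg] <;> positivity
    _ ≤ (‖y‖ ^ (m + 2))⁻¹ + (m + 2) * ‖y‖ ^ 2 * (‖y‖ ^ (m + 4))⁻¹ := by gcongr
    _ = (m + 3) * (‖y‖ ^ (m + 2))⁻¹ := by field_simp; ring
    _ ≤ _ := by gcongr

section Potential

variable {ν : Measure (EuclideanSpace ℝ (Fin n))} [IsFiniteMeasure ν]
  {x : EuclideanSpace ℝ (Fin n)} {δ : ℝ}

/-- The Riesz potential `∫ |x - ζ| ^ (-m) dν(ζ)`. -/
def rieszPotential (ν : Measure (EuclideanSpace ℝ (Fin n))) (m : ℕ)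
    (x : EuclideanSpace ℝ (Fin n)) : ℝ :=
  ∫ ζ, (‖x - ζ‖ ^ m)⁻¹ ∂ν

theorem integrable_kernel (hδ : 0 < δ) (h : ∀ᵐ ζ ∂ν, δ ≤ ‖x - ζ‖) (m : ℕ) :
    Integrable (fun ζ => (‖x - ζ‖ ^ m)⁻¹) ν := by
  refine Integrable.of_bound (Measurable.aestronglyMeasurable (by fun_prop)) (δ ^ m)⁻¹ ?_
  filter_upwards [h] with ζ hζ
  rw [Real.norm_eq_abs, abs_of_nonneg (by positivity)]
  exact inv_pow_norm_le hδ m hζ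

theorem integrable_kernel_deriv (hδ : 0 < δ) (h : ∀ᵐ ζ ∂ν, δ ≤ ‖x - ζ‖) (m : ℕ)
    {e : EuclideanSpace ℝ (Fin n)} (he : ‖e‖ = 1) :
    Integrable (fun ζ => -(m * inner ℝ (x - ζ) e * (‖x - ζ‖ ^ (m + 2))⁻¹)) ν := by
  refine Integrable.of_bound (Measurable.aestronglyMeasurable (by fun_prop)) _
    (h.mono fun ζ hζ => abs_kernel_deriv_le hδ m he hζ)

theorem integrable_kernel_deriv2 (hδ : 0 < δ) (h : ∀ᵐ ζ ∂ν, δ ≤ ‖x - ζ‖) (m : ℕ)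
    {e : EuclideanSpace ℝ (Fin n)} (he : ‖e‖ = 1) :
    Integrable (fun ζ => -(m * ((‖x - ζ‖ ^ (m + 2))⁻¹ -
      (m + 2) * inner ℝ (x - ζ) e ^ 2 * (‖x - ζ‖ ^ (m + 4))⁻¹))) ν := by
  refine Integrable.of_bound (Measurable.aestronglyMeasurable (by fun_prop)) _
    (h.mono fun ζ hζ => abs_kernel_deriv2_le hδ m he hζ)

theorem half_le_norm_of_mem_ball {ζ e : EuclideanSpace ℝ (Fin n)} {s : ℝ} (he : ‖e‖ = 1)
    (h : δ ≤ ‖x - ζ‖) (hs : s ∈ ball (0 : ℝ) (δ / 2)) : δ / 2 ≤ ‖(x - ζ) + s • e‖ := by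
  have h1 : ‖x - ζ‖ ≤ ‖(x - ζ) + s • e‖ + ‖s • e‖ := by
    simpa using norm_sub_le ((x - ζ) + s • e) (s • e)
  rw [norm_smul, he, mul_one] at h1
  rw [mem_ball_zero_iff] at hs
  linarith

theorem hasDerivAt_rieszPotential (hδ : 0 < δ) (h : ∀ᵐ ζ ∂ν, δ ≤ ‖x - ζ‖) (m : ℕ)
    {e : EuclideanSpace ℝ (Fin n)} (he : ‖e‖ = 1) {s : ℝ} (hs : s ∈ ball (0 : ℝ) (δ / 2)) :
    HasDerivAt (fun s : ℝ => rieszPotential ν m (x + s • e))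
      (∫ ζ, -(m * inner ℝ (x + s • e - ζ) e * (‖x + s • e - ζ‖ ^ (m + 2))⁻¹) ∂ν) s := by
  have hδ2 : 0 < δ / 2 := half_pos hδ
  have hsh : ∀ (s : ℝ) (ζ : EuclideanSpace ℝ (Fin n)), x + s • e - ζ = (x - ζ) + s • e :=
    fun s ζ => by abel
  have hfar : ∀ᵐ ζ ∂ν, δ / 2 ≤ ‖x + s • e - ζ‖ := h.mono fun ζ hζ => by
    rw [hsh]; exact half_le_norm_of_mem_ball he hζ hs
  refine (hasDerivAt_integral_of_dominated_loc_of_deriv_le (μ := ν)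
    (F := fun s ζ => (‖x + s • e - ζ‖ ^ m)⁻¹)
    (F' := fun s ζ => -(m * inner ℝ (x + s • e - ζ) e * (‖x + s • e - ζ‖ ^ (m + 2))⁻¹))
    (bound := fun _ => m * ((δ / 2) ^ (m + 1))⁻¹) (isOpen_ball.mem_nhds hs)
    (.of_forall fun s => Measurable.aestronglyMeasurable (by fun_prop))
    (integrable_kernel hδ2 hfar m) (integrable_kernel_deriv hδ2 hfar m he).1
    ?_ (integrable_const _) ?_).2
  · filter_upwards [h] with ζ hζ r hr
    refine abs_kernel_deriv_le hδ2 m he ?_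
    rw [hsh]
    exact half_le_norm_of_mem_ball he hζ hr
  · filter_upwards [h] with ζ hζ r hr
    simp only [hsh]
    exact hasDerivAt_kernel m (norm_pos_iff.1 (hδ2.trans_le (half_le_norm_of_mem_ball he hζ hr)))

theorem hasDeriv2At_rieszPotential (hδ : 0 < δ) (h : ∀ᵐ ζ ∂ν, δ ≤ ‖x - ζ‖) (m : ℕ)
    {e : EuclideanSpace ℝ (Fin n)} (he : ‖e‖ = 1) :
    HasDeriv2At (fun s : ℝ => rieszPotential ν m (x + s • e))
      (∫ ζ, -(m * inner ℝ (x - ζ) e * (‖x - ζ‖ ^ (m + 2))⁻¹) ∂ν)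
      (∫ ζ, -(m * ((‖x - ζ‖ ^ (m + 2))⁻¹ -
        (m + 2) * inner ℝ (x - ζ) e ^ 2 * (‖x - ζ‖ ^ (m + 4))⁻¹)) ∂ν) 0 := by
  have hδ2 : 0 < δ / 2 := half_pos hδ
  have hsh : ∀ (s : ℝ) (ζ : EuclideanSpace ℝ (Fin n)), x + s • e - ζ = (x - ζ) + s • e :=
    fun s ζ => by abel
  refine ⟨fun s => ∫ ζ, -(m * inner ℝ (x + s • e - ζ) e * (‖x + s • e - ζ‖ ^ (m + 2))⁻¹) ∂ν,
    ?_, by simp, ?_⟩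
  · filter_upwards [ball_mem_nhds (0 : ℝ) hδ2] with s hs
    exact hasDerivAt_rieszPotential hδ h m he hs
  · have key := (hasDerivAt_integral_of_dominated_loc_of_deriv_le (μ := ν) (x₀ := (0 : ℝ))
      (F := fun s ζ => -(m * inner ℝ (x + s • e - ζ) e * (‖x + s • e - ζ‖ ^ (m + 2))⁻¹))
      (F' := fun s ζ => -(m * ((‖x + s • e - ζ‖ ^ (m + 2))⁻¹ -
        (m + 2) * inner ℝ (x + s • e - ζ) e ^ 2 * (‖x + s • e - ζ‖ ^ (m + 4))⁻¹)))
      (bound := fun _ => m * ((m + 3) * ((δ / 2) ^ (m + 2))⁻¹)) (ball_mem_nhds (0 : ℝ) hδ2)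
      (.of_forall fun s => Measurable.aestronglyMeasurable (by fun_prop))
      (by simpa using integrable_kernel_deriv hδ h m he)
      (by simpa using (integrable_kernel_deriv2 hδ h m he).1)
      ?_ (integrable_const _) ?_).2
    · simpa using key
    · filter_upwards [h] with ζ hζ r hr
      refine abs_kernel_deriv2_le hδ2 m he ?_
      rw [hsh]
      exact half_le_norm_of_mem_ball he hζ hr
    · filter_upwards [h] with ζ hζ r hr
      simp only [hsh]
      exact hasDerivAt_kernel_deriv m he
        (norm_pos_iff.1 (hδ2.trans_le (half_le_norm_of_mem_ball he hζ hr)))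

theorem continuousAt_rieszPotential (hδ : 0 < δ) (h : ∀ᵐ ζ ∂ν, δ ≤ ‖x - ζ‖) (m : ℕ) :
    ContinuousAt (rieszPotential ν m) x := by
  have hδ2 : 0 < δ / 2 := half_pos hδ
  refine continuousAt_of_dominated (bound := fun _ => ((δ / 2) ^ m)⁻¹)
    (.of_forall fun y => Measurable.aestronglyMeasurable (by fun_prop)) ?_ (integrable_const _) ?_
  · filter_upwards [ball_mem_nhds x hδ2] with y hy
    filter_upwards [h] with ζ hζ
    rw [Real.norm_eq_abs, abs_of_nonneg (by positivity)]
    refine inv_pow_norm_le hδ2 m ?_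
    have h1 : ‖x - ζ‖ ≤ ‖x - y‖ + ‖y - ζ‖ := norm_sub_le_norm_sub_add_norm_sub x y ζ
    rw [mem_ball_iff_norm'] at hy
    linarith
  · filter_upwards [h] with ζ hζ
    have : ‖x - ζ‖ ^ m ≠ 0 := pow_ne_zero _ (hδ.trans_le hζ).ne'
    exact ContinuousAt.inv₀ (by fun_prop) this

/-- The vector `∫ (x - ζ) |x - ζ| ^ (-m) dν(ζ)`. -/
def rieszField (ν : Measure (EuclideanSpace ℝ (Fin n))) (m : ℕ)
    (x : EuclideanSpace ℝ (Fin n)) : EuclideanSpace ℝ (Fin n) :=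
  ∫ ζ, (‖x - ζ‖ ^ m)⁻¹ • (x - ζ) ∂ν

theorem integrable_field (hδ : 0 < δ) (h : ∀ᵐ ζ ∂ν, δ ≤ ‖x - ζ‖) (m : ℕ) :
    Integrable (fun ζ => (‖x - ζ‖ ^ (m + 1))⁻¹ • (x - ζ)) ν := by
  refine (integrable_kernel hδ h m).mono'
    (Measurable.aestronglyMeasurable (by fun_prop)) ?_
  filter_upwards [h] with ζ hζ
  have : 0 < ‖x - ζ‖ := hδ.trans_le hζ
  rw [norm_smul, Real.norm_eq_abs, abs_of_nonneg (by positivity)]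
  refine le_of_eq ?_
  field_simp
  ring

theorem integral_kernel_deriv_eq (hδ : 0 < δ) (h : ∀ᵐ ζ ∂ν, δ ≤ ‖x - ζ‖) (m : ℕ)
    (e : EuclideanSpace ℝ (Fin n)) :
    ∫ ζ, -(m * inner ℝ (x - ζ) e * (‖x - ζ‖ ^ (m + 2))⁻¹) ∂ν =
      -(m * inner ℝ e (rieszField ν (m + 2) x)) := by
  rw [rieszField, ← integral_inner (integrable_field hδ h (m + 1)), ← integral_const_mul,
    ← integral_neg]
  refine integral_congr_ae (.of_forall fun ζ => ?_)
  simp only [inner_smul_right, real_inner_comm e]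
  ring

theorem sum_inner_stdVec_sq (y : EuclideanSpace ℝ (Fin n)) :
    ∑ i, inner ℝ y (stdVec i) ^ 2 = ‖y‖ ^ 2 := by
  simp [EuclideanSpace.norm_sq_eq, EuclideanSpace.inner_single_right]

/-- The Laplacian of a Riesz potential. -/
theorem sum_integral_kernel_deriv2 (hδ : 0 < δ) (h : ∀ᵐ ζ ∂ν, δ ≤ ‖x - ζ‖) (m : ℕ) :
    ∑ i : Fin n, ∫ ζ, -(m * ((‖x - ζ‖ ^ (m + 2))⁻¹ -
        (m + 2) * inner ℝ (x - ζ) (stdVec i) ^ 2 * (‖x - ζ‖ ^ (m + 4))⁻¹)) ∂ν =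
      m * (m + 2 - n) * rieszPotential ν (m + 2) x := by
  rw [← integral_finsetSum _ fun i _ => integrable_kernel_deriv2 hδ h m (by simp),
    rieszPotential, ← integral_const_mul]
  refine integral_congr_ae ?_
  filter_upwards [h] with ζ hζ
  have : 0 < ‖x - ζ‖ := hδ.trans_le hζ
  rw [Finset.sum_neg_distrib, ← Finset.mul_sum, Finset.sum_sub_distrib, ← Finset.sum_mul,
    ← Finset.mul_sum, sum_inner_stdVec_sq]
  simp
  field_simp
  ring

end Potential

/-- The surface measure of the unit sphere, as a measure on the ambient space. -/
def sphereMeasure (n : ℕ) : Measure (EuclideanSpace ℝ (Fin n)) :=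
  (volume : Measure (EuclideanSpace ℝ (Fin n))).toSphere.map Subtype.val

instance : IsFiniteMeasure (sphereMeasure n) := by
  unfold sphereMeasure
  infer_instance

theorem ae_sphereMeasure_norm : ∀ᵐ ω ∂sphereMeasure n, ‖ω‖ = 1 := by
  unfold sphereMeasure
  rw [ae_map_iff (by fun_prop) (measurableSet_eq_fun (by fun_prop) (by fun_prop))]
  exact .of_forall fun ω => by simp

theorem sphereMeasure_real_univ : (sphereMeasure n).real univ = sphereArea n := by
  rw [sphereMeasure, sphereArea, map_measureReal_apply (by fun_prop) .univ, preimage_univ]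

theorem sphereMeasure_map_isometry
    (f : EuclideanSpace ℝ (Fin n) ≃ₗᵢ[ℝ] EuclideanSpace ℝ (Fin n)) :
    (sphereMeasure n).map f = sphereMeasure n := by
  ext s hs
  have hf : Measurable f := f.continuous.measurable
  rw [Measure.map_apply hf hs, sphereMeasure, Measure.map_apply (by fun_prop) (hf hs),
    Measure.map_apply (by fun_prop) hs,
    Measure.toSphere_apply' _ (measurable_subtype_coe (hf hs)),
    Measure.toSphere_apply' _ (measurable_subtype_coe hs)]
  congr 1
  have hset : Ioo (0 : ℝ) 1 • ((Subtype.val : sphere (0 : EuclideanSpace ℝ (Fin n)) 1 → _) ''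
        (Subtype.val ⁻¹' (f ⁻¹' s))) =
      f.toMeasurableEquiv ⁻¹' (Ioo (0 : ℝ) 1 •
        ((Subtype.val : sphere (0 : EuclideanSpace ℝ (Fin n)) 1 → _) ''
          (Subtype.val ⁻¹' s))) := by
    ext y
    simp only [Subtype.image_preimage_coe, Set.mem_smul, mem_inter_iff, mem_preimage,
      mem_sphere_zero_iff_norm]
    constructor
    · rintro ⟨r, hr, ω, ⟨h1, h2⟩, rfl⟩
      exact ⟨r, hr, f ω, ⟨by simpa using h1, h2⟩, by simp⟩
    · rintro ⟨r, hr, ω, ⟨h1, h2⟩, h3⟩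
      refine ⟨r, hr, f.symm ω, ⟨by simpa using h1, by simpa using h2⟩, ?_⟩
      rw [← map_smul, h3]
      simp
  rw [hset]
  exact f.measurePreserving.measure_preimage_equiv _

theorem rieszPotential_sphere_isometry (m : ℕ) (z : EuclideanSpace ℝ (Fin n))
    (f : EuclideanSpace ℝ (Fin n) ≃ₗᵢ[ℝ] EuclideanSpace ℝ (Fin n)) :
    rieszPotential (sphereMeasure n) m (f z) = rieszPotential (sphereMeasure n) m z := by
  unfold rieszPotential
  conv_lhs => rw [← sphereMeasure_map_isometry f]
  rw [integral_map f.continuous.measurable.aemeasurable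
    (Measurable.aestronglyMeasurable (by fun_prop))]
  refine integral_congr_ae (.of_forall fun ω => ?_)
  simp only [← map_sub, f.norm_map]

theorem rieszPotential_sphere_eq_of_norm_eq (m : ℕ) {z z' : EuclideanSpace ℝ (Fin n)}
    (h : ‖z‖ = ‖z'‖) :
    rieszPotential (sphereMeasure n) m z = rieszPotential (sphereMeasure n) m z' := by
  have := rieszPotential_sphere_isometry m z (Submodule.reflection (ℝ ∙ (z - z'))ᗮ)
  rw [Submodule.reflection_sub h] at this
  exact this.symm

theorem ae_sphereMeasure_far (z : EuclideanSpace ℝ (Fin n)) :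
    ∀ᵐ ω ∂sphereMeasure n, 1 - ‖z‖ ≤ ‖z - ω‖ := by
  filter_upwards [ae_sphereMeasure_norm] with ω hω
  rw [← hω, norm_sub_rev]
  exact norm_sub_norm_le ω z

theorem two_mul_inner_rieszField_sphere (m : ℕ) {z : EuclideanSpace ℝ (Fin n)} (hz : ‖z‖ < 1) :
    2 * inner ℝ z (rieszField (sphereMeasure n) (m + 2) z) =
      rieszPotential (sphereMeasure n) m z -
        (1 - ‖z‖ ^ 2) * rieszPotential (sphereMeasure n) (m + 2) z := by
  have hδ : 0 < 1 - ‖z‖ := sub_pos.2 hz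
  have hfar := ae_sphereMeasure_far z
  rw [rieszField, ← integral_inner (integrable_field hδ hfar (m + 1)), ← integral_const_mul,
    rieszPotential, rieszPotential, ← integral_const_mul,
    ← integral_sub (integrable_kernel hδ hfar m) ((integrable_kernel hδ hfar _).const_mul _)]
  refine integral_congr_ae ?_
  filter_upwards [hfar, ae_sphereMeasure_norm] with ω h1 h2
  have hpos : 0 < ‖z - ω‖ := hδ.trans_le h1
  have h3 : 2 * inner ℝ z (z - ω) = ‖z‖ ^ 2 + ‖z - ω‖ ^ 2 - 1 := by
    have := norm_sub_sq_real z (z - ω)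
    rw [sub_sub_cancel, h2] at this
    linarith
  have h4 : (‖z - ω‖ ^ m)⁻¹ = ‖z - ω‖ ^ 2 * (‖z - ω‖ ^ (m + 2))⁻¹ := by
    field_simp
    ring
  rw [inner_smul_right, h4, mul_left_comm, h3]
  ring

theorem continuousAt_sphere_potential {z : EuclideanSpace ℝ (Fin n)} (hz : ‖z‖ < 1) :
    ContinuousAt (fun y => (1 - ‖y‖ ^ 2) * rieszPotential (sphereMeasure n) n y) z :=
  ContinuousAt.mul (by fun_prop)
    (continuousAt_rieszPotential (sub_pos.2 hz) (ae_sphereMeasure_far z) n)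

/-- The average of the Poisson kernel over its poles is harmonic. -/
theorem exists_deriv2_sphere_potential {z : EuclideanSpace ℝ (Fin n)} (hz : ‖z‖ < 1) :
    ∃ a b : Fin n → ℝ, (∀ i, HasDeriv2At (fun s => (1 - ‖z + s • stdVec i‖ ^ 2) *
      rieszPotential (sphereMeasure n) n (z + s • stdVec i)) (a i) (b i) 0) ∧ ∑ i, b i = 0 := by
  have hδ : 0 < 1 - ‖z‖ := sub_pos.2 hz
  have hfar := ae_sphereMeasure_far z
  refine ⟨_, _, fun i => ((HasDeriv2At.const 1 0).sub (hasDeriv2At_norm_sq z (stdVec i))).mul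
    (hasDeriv2At_rieszPotential hδ hfar n (by simp)), ?_⟩
  simp only [integral_kernel_deriv_eq hδ hfar]
  simp only [zero_smul, add_zero]
  rw [Finset.sum_add_distrib, ← Finset.mul_sum, sum_integral_kernel_deriv2 hδ hfar,
    Finset.sum_add_distrib, ← Finset.mul_sum]
  have hin : ∑ i, (0 - 2 * inner ℝ z (stdVec i)) *
      -((n : ℝ) * inner ℝ (stdVec i) (rieszField (sphereMeasure n) (n + 2) z)) =
      2 * n * inner ℝ z (rieszField (sphereMeasure n) (n + 2) z) := by
    rw [← (EuclideanSpace.basisFun (Fin n) ℝ).sum_inner_mul_inner, Finset.mul_sum]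
    refine Finset.sum_congr rfl fun i _ => ?_
    simp only [EuclideanSpace.basisFun_apply]
    ring
  rw [hin]
  have h2 := two_mul_inner_rieszField_sphere n hz
  simp
  linear_combination 2 * n * h2

theorem sphere_potential_eq_zero_value (hn : 0 < n) {z : EuclideanSpace ℝ (Fin n)}
    (hz : ‖z‖ < 1) :
    (1 - ‖z‖ ^ 2) * rieszPotential (sphereMeasure n) n z = rieszPotential (sphereMeasure n) n 0 := by
  have : Nonempty (Fin n) := ⟨⟨0, hn⟩⟩
  rcases eq_or_ne z 0 with rfl | hz0
  · simp
  set V : EuclideanSpace ℝ (Fin n) → ℝ :=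
    fun y => (1 - ‖y‖ ^ 2) * rieszPotential (sphereMeasure n) n y with hV
  have hV0 : V 0 = rieszPotential (sphereMeasure n) n 0 := by simp [hV]
  have hK := isCompact_closedBall (0 : EuclideanSpace ℝ (Fin n)) ‖z‖
  have hlt : ∀ y ∈ closedBall (0 : EuclideanSpace ℝ (Fin n)) ‖z‖, ‖y‖ < 1 := fun y hy =>
    (mem_closedBall_zero_iff.1 hy).trans_lt hz
  have hcont : ContinuousOn V (closedBall 0 ‖z‖) := fun y hy =>
    (continuousAt_sphere_potential (hlt y hy)).continuousWithinAt
  have hfr : ∀ y ∈ frontier (closedBall (0 : EuclideanSpace ℝ (Fin n)) ‖z‖), V y = V z := by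
    intro y hy
    rw [frontier_closedBall _ (norm_ne_zero_iff.2 hz0), mem_sphere_zero_iff_norm] at hy
    simp only [hV, hy, rieszPotential_sphere_eq_of_norm_eq n hy]
  have h0 : (0 : EuclideanSpace ℝ (Fin n)) ∈ closedBall (0 : EuclideanSpace ℝ (Fin n)) ‖z‖ := by
    simp
  have hup : V 0 - V z ≤ 0 := by
    refine nonpos_of_sum_deriv2_nonneg hn (w := fun y => V y - V z) hK
      (hcont.sub continuousOn_const) (fun y hy => ?_) (fun y hy => by simp [hfr y hy]) 0 h0
    obtain ⟨a, b, hab, hs⟩ := exists_deriv2_sphere_potential (hlt y (interior_subset hy))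
    exact ⟨_, _, fun i => (hab i).sub (HasDeriv2At.const _ 0), by simp [hs]⟩
  have hdown : V z - V 0 ≤ 0 := by
    refine nonpos_of_sum_deriv2_nonneg hn (w := fun y => V z - V y) hK
      (continuousOn_const.sub hcont) (fun y hy => ?_) (fun y hy => by simp [hfr y hy]) 0 h0
    obtain ⟨a, b, hab, hs⟩ := exists_deriv2_sphere_potential (hlt y (interior_subset hy))
    exact ⟨_, _, fun i => (HasDeriv2At.const _ 0).sub (hab i), by simp [hs]⟩
  rw [← hV0]
  change V z = V 0
  linarith

/-- The mean value of the Poisson kernel. -/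
theorem rieszPotential_sphere (hn : 0 < n) {z : EuclideanSpace ℝ (Fin n)} (hz : ‖z‖ < 1) :
    rieszPotential (sphereMeasure n) n z = sphereArea n / (1 - ‖z‖ ^ 2) := by
  have h1 : 0 < 1 - ‖z‖ ^ 2 := by nlinarith [norm_nonneg z]
  have h2 : rieszPotential (sphereMeasure n) n 0 = sphereArea n := by
    rw [rieszPotential, ← sphereMeasure_real_univ, ← mul_one ((sphereMeasure n).real univ),
      ← smul_eq_mul, ← integral_const]
    refine integral_congr_ae ?_
    filter_upwards [ae_sphereMeasure_norm] with ω hω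
    simp [hω]
  rw [eq_div_iff h1.ne', mul_comm, sphere_potential_eq_zero_value hn hz, h2]

theorem rieszPotential_sphere_add_two (hn : 0 < n) {z : EuclideanSpace ℝ (Fin n)}
    (hz0 : z ≠ 0) (hz : ‖z‖ < 1) :
    rieszPotential (sphereMeasure n) (n + 2) z =
      sphereArea n * (1 / (1 - ‖z‖ ^ 2) ^ 2 + 4 * ‖z‖ ^ 2 / n / (1 - ‖z‖ ^ 2) ^ 3) := by
  have h1 : 0 < 1 - ‖z‖ ^ 2 := by nlinarith [norm_nonneg z]
  have hzpos : 0 < ‖z‖ := norm_pos_iff.2 hz0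
  have hδ : 0 < 1 - ‖z‖ := sub_pos.2 hz
  have hfar := ae_sphereMeasure_far z
  set e : EuclideanSpace ℝ (Fin n) := ‖z‖⁻¹ • z with he
  have hze : ‖z‖ • e = z := by rw [he, smul_inv_smul₀ hzpos.ne']
  have he1 : ‖e‖ = 1 := norm_smul_inv_norm (𝕜 := ℝ) hz0
  have hd := (hasDeriv2At_rieszPotential hδ hfar n he1).hasDerivAt
  rw [integral_kernel_deriv_eq hδ hfar] at hd
  have hd' : HasDerivAt (fun s : ℝ => sphereArea n / (1 - (‖z‖ + s) ^ 2))
      (sphereArea n * (2 * ‖z‖) / (1 - ‖z‖ ^ 2) ^ 2) 0 := by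
    have h2 : HasDerivAt (fun s : ℝ => 1 - (‖z‖ + s) ^ 2) (-(2 * ‖z‖)) 0 := by
      simpa using (((hasDerivAt_id (0 : ℝ)).const_add ‖z‖).pow 2).const_sub 1
    have h3 := (hasDerivAt_const (0 : ℝ) (sphereArea n)).div h2 (by simpa using h1.ne')
    refine h3.congr_deriv ?_
    simp
  have heq : (fun s : ℝ => rieszPotential (sphereMeasure n) n (z + s • e)) =ᶠ[𝓝 0]
      fun s : ℝ => sphereArea n / (1 - (‖z‖ + s) ^ 2) := by
    filter_upwards [ball_mem_nhds (0 : ℝ) hδ] with s hs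
    have hn' : ‖z + s • e‖ = |‖z‖ + s| := by
      rw [← Real.norm_eq_abs, ← mul_one ‖‖z‖ + s‖, ← he1, ← norm_smul, add_smul, hze]
    rw [mem_ball_zero_iff, Real.norm_eq_abs] at hs
    rw [rieszPotential_sphere hn, hn', sq_abs]
    rw [hn']
    exact (abs_add_le _ _).trans_lt (by rw [abs_of_pos hzpos]; linarith)
  have hder := hd.unique (hd'.congr_of_eventuallyEq heq)
  have hin : inner ℝ z (rieszField (sphereMeasure n) (n + 2) z) =
      ‖z‖ * inner ℝ e (rieszField (sphereMeasure n) (n + 2) z) := by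
    rw [← real_inner_smul_left, hze]
  have h2 := two_mul_inner_rieszField_sphere n hz
  rw [hin, rieszPotential_sphere hn hz] at h2
  have hnR : (n : ℝ) ≠ 0 := by positivity
  have hI : inner ℝ e (rieszField (sphereMeasure n) (n + 2) z) =
      -(sphereArea n * (2 * ‖z‖) / (1 - ‖z‖ ^ 2) ^ 2) / n := by
    rw [eq_div_iff hnR]
    linarith
  rw [hI] at h2
  have h3 : (1 - ‖z‖ ^ 2) * rieszPotential (sphereMeasure n) (n + 2) z =
      (1 - ‖z‖ ^ 2) * (sphereArea n * (1 / (1 - ‖z‖ ^ 2) ^ 2 +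
        4 * ‖z‖ ^ 2 / n / (1 - ‖z‖ ^ 2) ^ 3)) := by
    have : (1 - ‖z‖ ^ 2) * rieszPotential (sphereMeasure n) (n + 2) z =
      sphereArea n / (1 - ‖z‖ ^ 2) -
        2 * (‖z‖ * (-(sphereArea n * (2 * ‖z‖) / (1 - ‖z‖ ^ 2) ^ 2) / n)) := by linarith
    rw [this]
    field_simp
    ring
  exact mul_left_cancel₀ h1.ne' h3

section

/-- Integration in polar coordinates. -/
theorem integral_eq_integral_polar (hn : 0 < n) {f : EuclideanSpace ℝ (Fin n) → ℝ}
    (hf : Integrable f) :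
    ∫ x, f x = ∫ s in Ioi (0 : ℝ), s ^ (n - 1) * ∫ ω, f (s • ω) ∂sphereMeasure n := by
  have : Nonempty (Fin n) := ⟨⟨0, hn⟩⟩
  set μ : Measure (EuclideanSpace ℝ (Fin n)) := volume with hμ
  have hdim : Module.finrank ℝ (EuclideanSpace ℝ (Fin n)) = n := by simp
  have hmp := μ.measurePreserving_homeomorphUnitSphereProd
  rw [hdim] at hmp
  have hemb := (homeomorphUnitSphereProd (EuclideanSpace ℝ (Fin n))).measurableEmbedding
  set g : sphere (0 : EuclideanSpace ℝ (Fin n)) 1 × Ioi (0 : ℝ) → ℝ :=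
    fun p => f (p.2.1 • p.1.1) with hg
  have hcomp : g ∘ homeomorphUnitSphereProd (EuclideanSpace ℝ (Fin n)) = fun x => f x.1 := by
    funext x
    have hx : ‖x.1‖ ≠ 0 := norm_ne_zero_iff.2 x.2
    simp [hg, smul_smul, hx]
  have hgint : Integrable g (μ.toSphere.prod (Measure.volumeIoiPow (n - 1))) := by
    rw [← hmp.integrable_comp_emb hemb, hcomp]
    exact (integrableOn_iff_comap_subtypeVal (measurableSet_singleton _).compl).1 hf.integrableOn
  calc ∫ x, f x ∂μ = ∫ x : ({(0)}ᶜ : Set (EuclideanSpace ℝ (Fin n))), f x.1 ∂(μ.comap (↑)) := by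
        rw [integral_subtype_comap (measurableSet_singleton _).compl fun x ↦ f x,
          restrict_compl_singleton]
    _ = ∫ p, g p ∂μ.toSphere.prod (.volumeIoiPow (n - 1)) := by
        rw [← hmp.integral_comp hemb]
        exact integral_congr_ae (.of_forall fun x => (congrFun hcomp x).symm)
    _ = ∫ s : Ioi (0 : ℝ), ∫ ω, g (ω, s) ∂μ.toSphere ∂.volumeIoiPow (n - 1) :=
        integral_prod_symm _ hgint
    _ = ∫ s : Ioi (0 : ℝ), ∫ ω, f (s.1 • ω) ∂sphereMeasure n ∂.volumeIoiPow (n - 1) := by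
        refine integral_congr_ae (.of_forall fun s => ?_)
        exact ((MeasurableEmbedding.subtype_coe isClosed_sphere.measurableSet).integral_map
          (fun ω => f (s.1 • ω))).symm
    _ = _ := by
      simp only [Measure.volumeIoiPow, ENNReal.ofReal]
      rw [integral_withDensity_eq_integral_smul,
        integral_subtype_comap measurableSet_Ioi
          fun a ↦ Real.toNNReal (a ^ (n - 1)) • ∫ ω, f (a • ω) ∂sphereMeasure n,
        setIntegral_congr_fun measurableSet_Ioi fun x hx ↦ ?_]
      · rw [NNReal.smul_def, Real.coe_toNNReal _ (pow_nonneg hx.out.le _), smul_eq_mul]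
      · exact (measurable_subtype_coe.pow_const _).real_toNNReal

theorem setIntegral_ball_eq_integral_polar (hn : 0 < n) {f : EuclideanSpace ℝ (Fin n) → ℝ}
    {t : ℝ} (hf : IntegrableOn f (ball 0 t)) :
    ∫ x in ball 0 t, f x = ∫ s in Ioo (0 : ℝ) t, s ^ (n - 1) * ∫ ω, f (s • ω) ∂sphereMeasure n := by
  rw [← integral_indicator measurableSet_ball, integral_eq_integral_polar hn
    ((integrable_indicator_iff measurableSet_ball).2 hf), ← Ioi_inter_Iio,
    ← setIntegral_indicator measurableSet_Iio]
  refine setIntegral_congr_fun measurableSet_Ioi fun s hs => ?_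
  have hs' : (0 : ℝ) < s := hs
  have h : ∀ᵐ ω ∂sphereMeasure n, (ball 0 t).indicator f (s • ω) =
      if s < t then f (s • ω) else 0 := by
    filter_upwards [ae_sphereMeasure_norm] with ω hω
    simp [indicator, norm_smul, hω, abs_of_pos hs']
  rw [integral_congr_ae h]
  by_cases hst : s < t <;> simp [hst]

variable {e : EuclideanSpace ℝ (Fin n)} {t : ℝ}

theorem norm_add_smul_eq {ω : EuclideanSpace ℝ (Fin n)} (he : ‖e‖ = 1) (hω : ‖ω‖ = 1) (s : ℝ) :
    ‖e + s • ω‖ = ‖-(s • e) - ω‖ := by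
  rw [← norm_neg (-(s • e) - ω), neg_sub, sub_neg_eq_add, ← sq_eq_sq₀ (norm_nonneg _) (norm_nonneg _),
    norm_add_sq_real, norm_add_sq_real, norm_smul, norm_smul, he, hω, real_inner_smul_right,
    real_inner_smul_right, real_inner_comm]

theorem integral_sphere_inv_pow (he : ‖e‖ = 1) (m : ℕ) (s : ℝ) :
    ∫ ω, (‖e + s • ω‖ ^ m)⁻¹ ∂sphereMeasure n =
      rieszPotential (sphereMeasure n) m (-(s • e)) := by
  refine integral_congr_ae ?_
  filter_upwards [ae_sphereMeasure_norm] with ω hω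
  rw [norm_add_smul_eq he hω]

theorem one_sub_le_norm_add {z : EuclideanSpace ℝ (Fin n)} (he : ‖e‖ = 1) :
    1 - ‖z‖ ≤ ‖e + z‖ := by
  have := norm_sub_norm_le e (-z)
  rwa [he, norm_neg, sub_neg_eq_add] at this

theorem continuousOn_inv_pow (he : ‖e‖ = 1) (ht : t < 1) (m : ℕ) :
    ContinuousOn (fun z => (‖e + z‖ ^ m)⁻¹) (closedBall 0 t) := by
  intro z hz
  have h := one_sub_le_norm_add (z := z) he
  rw [mem_closedBall_zero_iff] at hz
  have : ‖e + z‖ ^ m ≠ 0 := pow_ne_zero _ (by linarith)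
  have hc : Continuous fun z => ‖e + z‖ ^ m := by fun_prop
  exact (hc.continuousAt.inv₀ this).continuousWithinAt

theorem integrableOn_ball_of_continuousOn {f : EuclideanSpace ℝ (Fin n) → ℝ}
    (hf : ContinuousOn f (closedBall 0 t)) : IntegrableOn f (ball 0 t) :=
  (hf.integrableOn_compact (isCompact_closedBall _ _)).mono_set ball_subset_closedBall

theorem setIntegral_Ioo_eq_sub {f g : ℝ → ℝ} (ht : 0 ≤ t)
    (hf : ∀ s ∈ Icc 0 t, HasDerivAt f (g s) s) (hg : ContinuousOn g (Icc 0 t)) :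
    ∫ s in Ioo 0 t, g s = f t - f 0 := by
  rw [← integral_Ioc_eq_integral_Ioo, ← intervalIntegral.integral_of_le ht]
  refine intervalIntegral.integral_eq_sub_of_hasDerivAt (fun s hs => hf s ?_) ?_
  · rwa [uIcc_of_le ht] at hs
  · exact ContinuousOn.intervalIntegrable (by rwa [uIcc_of_le ht])

theorem setIntegral_ball_kernel (hn : 0 < n) (he : ‖e‖ = 1) (ht : t < 1) :
    ∫ z in ball 0 t, (‖e + z‖ ^ n)⁻¹ =
      sphereArea n * ∫ s in Ioo 0 t, s ^ (n - 1) / (1 - s ^ 2) := by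
  rw [setIntegral_ball_eq_integral_polar hn
    (integrableOn_ball_of_continuousOn (continuousOn_inv_pow he ht n)), ← integral_const_mul]
  refine setIntegral_congr_fun measurableSet_Ioo fun s hs => ?_
  have hns : ‖-(s • e)‖ = s := by rw [norm_neg, norm_smul, he, mul_one, Real.norm_of_nonneg hs.1.le]
  rw [integral_sphere_inv_pow he, rieszPotential_sphere hn (by rw [hns]; exact hs.2.trans ht), hns]
  ring

theorem integrable_sphere_inv_pow (he : ‖e‖ = 1) (m : ℕ) {s : ℝ} (hs0 : 0 ≤ s) (hs1 : s < 1) :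
    Integrable (fun ω => (‖e + s • ω‖ ^ m)⁻¹) (sphereMeasure n) := by
  have hns : ‖-(s • e)‖ = s := by rw [norm_neg, norm_smul, he, mul_one, Real.norm_of_nonneg hs0]
  refine (integrable_kernel (x := -(s • e)) (sub_pos.2 (by rw [hns]; exact hs1))
    (ae_sphereMeasure_far _) m).congr ?_
  filter_upwards [ae_sphereMeasure_norm] with ω hω
  rw [norm_add_smul_eq he hω]

theorem setIntegral_ball_extremal (hn : 0 < n) (he : ‖e‖ = 1) (ht0 : 0 ≤ t) (ht : t < 1) :
    ∫ z in ball 0 t, ((‖e + z‖ ^ n)⁻¹ + (t ^ 2 - ‖z‖ ^ 2) * (‖e + z‖ ^ (n + 2))⁻¹) =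
      sphereArea n / n * (t ^ n / (1 - t ^ 2)) := by
  have hnR : (n : ℝ) ≠ 0 := by positivity
  have hden : ∀ s ∈ Icc 0 t, 0 < 1 - s ^ 2 := fun s hs => by nlinarith [hs.1, hs.2]
  have hpoly : ∀ s ∈ Ioo 0 t, s ^ (n - 1) * ∫ ω, ((‖e + s • ω‖ ^ n)⁻¹ +
      (t ^ 2 - ‖s • ω‖ ^ 2) * (‖e + s • ω‖ ^ (n + 2))⁻¹) ∂sphereMeasure n =
      sphereArea n * (s ^ (n - 1) * (1 / (1 - s ^ 2) +
        (t ^ 2 - s ^ 2) * (1 / (1 - s ^ 2) ^ 2 + 4 * s ^ 2 / n / (1 - s ^ 2) ^ 3))) := by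
    intro s hs
    have hs1 : s < 1 := hs.2.trans ht
    have hns : ‖-(s • e)‖ = s := by
      rw [norm_neg, norm_smul, he, mul_one, Real.norm_of_nonneg hs.1.le]
    have h1 : ∫ ω, ((‖e + s • ω‖ ^ n)⁻¹ +
        (t ^ 2 - ‖s • ω‖ ^ 2) * (‖e + s • ω‖ ^ (n + 2))⁻¹) ∂sphereMeasure n =
        ∫ ω, ((‖e + s • ω‖ ^ n)⁻¹ +
          (t ^ 2 - s ^ 2) * (‖e + s • ω‖ ^ (n + 2))⁻¹) ∂sphereMeasure n := by
      refine integral_congr_ae ?_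
      filter_upwards [ae_sphereMeasure_norm] with ω hω
      rw [norm_smul, hω, mul_one, Real.norm_of_nonneg hs.1.le]
    rw [h1, integral_add (integrable_sphere_inv_pow he n hs.1.le hs1)
      ((integrable_sphere_inv_pow he _ hs.1.le hs1).const_mul _), integral_const_mul,
      integral_sphere_inv_pow he, integral_sphere_inv_pow he,
      rieszPotential_sphere hn (by rw [hns]; exact hs1),
      rieszPotential_sphere_add_two hn (by rw [← norm_pos_iff, hns]; exact hs.1)
        (by rw [hns]; exact hs1), hns]
    ring
  rw [setIntegral_ball_eq_integral_polar hn, setIntegral_congr_fun measurableSet_Ioo hpoly,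
    integral_const_mul, setIntegral_Ioo_eq_sub
      (f := fun s => (2 * s ^ n / (1 - s ^ 2) - (1 - t ^ 2) * (s ^ n / (1 - s ^ 2) ^ 2)) / n) ht0]
  · have := (hden t ⟨ht0, le_rfl⟩).ne'
    simp only [zero_pow hn.ne']
    field_simp
    ring
  · intro s hs
    have h0 := (hden s hs).ne'
    have hd : HasDerivAt (fun s : ℝ => 1 - s ^ 2) (-(2 * s)) s := by
      simpa using (hasDerivAt_pow 2 s).const_sub 1
    have hp : HasDerivAt (fun s : ℝ => s ^ n) (n * s ^ (n - 1)) s := hasDerivAt_pow n s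
    have := (((hp.const_mul 2).div hd h0).sub
      ((hp.div (hd.pow 2) (pow_ne_zero 2 h0)).const_mul (1 - t ^ 2))).div_const (n : ℝ)
    refine this.congr_deriv ?_
    obtain ⟨k, rfl⟩ : ∃ k, n = k + 1 := ⟨n - 1, by omega⟩
    simp only [Nat.add_sub_cancel, Pi.pow_apply]
    field_simp
    ring
  · have h0 : ∀ s ∈ Icc 0 t, 1 - s ^ 2 ≠ 0 := fun s hs => (hden s hs).ne'
    have h2 : ∀ s ∈ Icc 0 t, (1 - s ^ 2) ^ 2 ≠ 0 := fun s hs => pow_ne_zero _ (h0 s hs)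
    have h3 : ∀ s ∈ Icc 0 t, (1 - s ^ 2) ^ 3 ≠ 0 := fun s hs => pow_ne_zero _ (h0 s hs)
    fun_prop (disch := assumption)
  · refine integrableOn_ball_of_continuousOn ((continuousOn_inv_pow he ht n).add
      (ContinuousOn.mul (by fun_prop) (continuousOn_inv_pow he ht _)))

end

theorem one_sub_sq_le_mul {n : ℕ} (hn : 2 ≤ n) {s : ℝ} (hs0 : 0 ≤ s) :
    1 - s ^ 2 ≤ (1 - s ^ n) * (1 - (1 - 2 / (n : ℝ)) * s ^ n) := by
  obtain ⟨k, rfl⟩ : ∃ k, n = k + 2 := ⟨n - 2, by omega⟩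
  have hk : (0 : ℝ) < 2 * k + 2 := by positivity
  have hAG : (2 * k + 2) * s ^ k ≤ (k + 2) + k * s ^ (2 * k + 2) := by
    have h := Real.geom_mean_le_arith_mean2_weighted (w₁ := (k + 2) / (2 * k + 2))
      (w₂ := k / (2 * k + 2)) (p₁ := 1) (p₂ := s ^ (2 * k + 2)) (by positivity) (by positivity)
      zero_le_one (by positivity) (by field_simp; ring)
    rw [Real.one_rpow, one_mul, ← Real.rpow_natCast, ← Real.rpow_mul hs0] at h
    have h2 : ((2 * k + 2 : ℕ) : ℝ) * (k / (2 * k + 2)) = k := by push_cast; field_simp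
    rw [h2, Real.rpow_natCast, Real.rpow_natCast] at h
    have h3 := mul_le_mul_of_nonneg_left h hk.le
    have h4 : (2 * k + 2 : ℝ) * ((k + 2) / (2 * k + 2) * 1 + k / (2 * k + 2) * s ^ (2 * k + 2)) =
      (k + 2) + k * s ^ (2 * k + 2) := by field_simp
    linarith
  have hsk : s ^ 2 * ((2 * k + 2) * s ^ k) ≤ s ^ 2 * ((k + 2) + k * s ^ (2 * k + 2)) := by gcongr
  have hid : (1 - s ^ (k + 2)) * (1 - (1 - 2 / ((k + 2 : ℕ) : ℝ)) * s ^ (k + 2)) - (1 - s ^ 2) =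
      (s ^ 2 * ((k + 2) + k * s ^ (2 * k + 2)) - s ^ 2 * ((2 * k + 2) * s ^ k)) / (k + 2) := by
    push_cast
    field_simp
    ring
  have : 0 ≤ (s ^ 2 * ((k + 2) + k * s ^ (2 * k + 2)) - s ^ 2 * ((2 * k + 2) * s ^ k)) /
      ((k : ℝ) + 2) := div_nonneg (by linarith) (by positivity)
  linarith

theorem log_le_setIntegral {n : ℕ} (hn : 2 ≤ n) {t : ℝ} (ht0 : 0 ≤ t) (ht : t < 1) :
    Real.log ((1 - (1 - 2 / (n : ℝ)) * t ^ n) / (1 - t ^ n)) ≤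
      2 * ∫ s in Ioo 0 t, s ^ (n - 1) / (1 - s ^ 2) := by
  have hn2 : (2 : ℝ) ≤ n := by exact_mod_cast hn
  have hα0 : 0 ≤ 1 - 2 / (n : ℝ) := by
    rw [sub_nonneg, div_le_one (by linarith)]; exact hn2
  have hα1 : 1 - 2 / (n : ℝ) < 1 := by
    have : (0 : ℝ) < 2 / n := by positivity
    linarith
  set α : ℝ := 1 - 2 / (n : ℝ) with hα
  have hlt : ∀ s ∈ Icc 0 t, s ^ n < 1 := fun s hs =>
    pow_lt_one₀ hs.1 (hs.2.trans_lt ht) (by omega)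
  have hp1 : ∀ s ∈ Icc 0 t, 0 < 1 - s ^ n := fun s hs => sub_pos.2 (hlt s hs)
  have hp2 : ∀ s ∈ Icc 0 t, 0 < 1 - α * s ^ n := fun s hs => by
    have := mul_le_of_le_one_left (pow_nonneg hs.1 n) hα1.le
    linarith [hlt s hs]
  have hp3 : ∀ s ∈ Icc 0 t, 0 < 1 - s ^ 2 := fun s hs => by nlinarith [hs.1, hs.2]
  have hc1 : ContinuousOn (fun s : ℝ => s ^ (n - 1) / (1 - s ^ 2)) (Icc 0 t) := by
    have h0 : ∀ s ∈ Icc 0 t, 1 - s ^ 2 ≠ 0 := fun s hs => (hp3 s hs).ne'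
    fun_prop (disch := assumption)
  have hc2 : ContinuousOn (fun s : ℝ => 2 * (s ^ (n - 1) / ((1 - s ^ n) * (1 - α * s ^ n))))
      (Icc 0 t) := by
    have h0 : ∀ s ∈ Icc 0 t, (1 - s ^ n) * (1 - α * s ^ n) ≠ 0 :=
      fun s hs => (mul_pos (hp1 s hs) (hp2 s hs)).ne'
    fun_prop (disch := assumption)
  have hint : ∫ s in Ioo 0 t, 2 * (s ^ (n - 1) / ((1 - s ^ n) * (1 - α * s ^ n))) =
      Real.log ((1 - α * t ^ n) / (1 - t ^ n)) := by
    rw [setIntegral_Ioo_eq_sub (f := fun s => Real.log (1 - α * s ^ n) - Real.log (1 - s ^ n)) ht0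
      ?_ hc2]
    · rw [Real.log_div (hp2 t ⟨ht0, le_rfl⟩).ne' (hp1 t ⟨ht0, le_rfl⟩).ne']
      simp [show n ≠ 0 by omega]
    · intro s hs
      have h1 := (hp1 s hs).ne'
      have h2 := (hp2 s hs).ne'
      have hp : HasDerivAt (fun s : ℝ => s ^ n) (n * s ^ (n - 1)) s := hasDerivAt_pow n s
      have := (((hp.const_mul α).const_sub 1).log h2).sub ((hp.const_sub 1).log h1)
      refine this.congr_deriv ?_
      have hnα : (n : ℝ) * (1 - α) = 2 := by rw [hα]; field_simp; ring
      field_simp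
      linear_combination (s ^ (n - 1)) * hnα
  rw [← hint, ← integral_const_mul]
  refine setIntegral_mono_on
    ((hc2.integrableOn_compact isCompact_Icc).mono_set Ioo_subset_Icc_self)
    (((hc1.integrableOn_compact isCompact_Icc).mono_set Ioo_subset_Icc_self).const_mul 2)
    measurableSet_Ioo fun s hs => ?_
  have hs' := Ioo_subset_Icc_self hs
  have h1 := hp3 s hs'
  have := one_sub_sq_le_mul hn hs.1.le
  have h0 : 0 ≤ s ^ (n - 1) := pow_nonneg hs.1.le _
  gcongr

section

theorem sphereArea_pos (hn : 0 < n) : 0 < sphereArea n := by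
  have : Nonempty (Fin n) := ⟨⟨0, hn⟩⟩
  have h : 0 < (volume : Measure (EuclideanSpace ℝ (Fin n))).real (ball 0 1) :=
    ENNReal.toReal_pos (measure_ball_pos _ _ one_pos).ne' measure_ball_lt_top.ne
  rw [sphereArea, Measure.toSphere_real_apply_univ]
  simpa [hn] using h

theorem integral_affine_change (f : EuclideanSpace ℝ (Fin n) → ℝ)
    (x e : EuclideanSpace ℝ (Fin n)) {b : ℝ} (hb : 0 < b) :
    ∫ ζ, f ζ = b ^ n * ∫ z, f (x - b • (e + z)) := by
  have h1 := integral_add_left_eq_self (μ := volume) (fun w => f (x - b • w)) e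
  have h2 := Measure.integral_comp_smul volume (fun y => f (x - y)) b
  have h3 := integral_sub_left_eq_self f volume x
  rw [h1, h2, h3, finrank_euclideanSpace, Fintype.card_fin, abs_of_pos (by positivity), smul_eq_mul,
    mul_inv_cancel_left₀ (by positivity)]

variable {ν : Measure (EuclideanSpace ℝ (Fin n))} [IsFiniteMeasure ν]
  {x e : EuclideanSpace ℝ (Fin n)} {δ b t : ℝ}

theorem inner_sub_eq (he : ‖e‖ = 1) (hb : 0 < b) (y : EuclideanSpace ℝ (Fin n)) :
    inner ℝ e y - b * (1 - t ^ 2) / 2 - 1 / (2 * b) * ‖y‖ ^ 2 =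
      1 / (2 * b) * ((b * t) ^ 2 - ‖y - b • e‖ ^ 2) := by
  rw [norm_sub_sq_real, norm_smul, he, inner_smul_right, Real.norm_of_nonneg hb.le,
    real_inner_comm e]
  field_simp
  ring

/-- Among densities bounded by one, the field of the indicator of a ball is extremal. -/
theorem inner_rieszField_le (hν : ν ≤ volume) (hδ : 0 < δ) (h : ∀ᵐ ζ ∂ν, δ ≤ ‖x - ζ‖)
    (he : ‖e‖ = 1) (hb : 0 < b) (ht0 : 0 ≤ t) (ht : t < 1) :
    inner ℝ e (rieszField ν (n + 2) x) ≤
      b * (1 - t ^ 2) / 2 * rieszPotential ν (n + 2) x +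
      1 / (2 * b) * (rieszPotential ν n x +
        ∫ z in ball 0 t, (t ^ 2 - ‖z‖ ^ 2) * (‖e + z‖ ^ (n + 2))⁻¹) := by
  set f : EuclideanSpace ℝ (Fin n) → ℝ := fun ζ =>
    1 / (2 * b) * ((b * t) ^ 2 - ‖x - ζ - b • e‖ ^ 2) * (‖x - ζ‖ ^ (n + 2))⁻¹ with hf
  set S : Set (EuclideanSpace ℝ (Fin n)) := ball (x - b • e) (b * t) with hS
  have hmemS : ∀ ζ, ζ ∈ S ↔ ‖x - ζ - b • e‖ < b * t := fun ζ => by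
    rw [hS, mem_ball_iff_norm', sub_right_comm]
  have hI := integrable_kernel hδ h n
  have hA := integrable_kernel hδ h (n + 2)
  have hF : Integrable (fun ζ => inner ℝ e ((‖x - ζ‖ ^ (n + 2))⁻¹ • (x - ζ))) ν :=
    (integrable_field hδ h (n + 1)).const_inner (𝕜 := ℝ) e
  have hFA : Integrable (fun ζ => inner ℝ e ((‖x - ζ‖ ^ (n + 2))⁻¹ • (x - ζ)) -
      b * (1 - t ^ 2) / 2 * (‖x - ζ‖ ^ (n + 2))⁻¹) ν := hF.sub (hA.const_mul _)
  have hae : (fun ζ => inner ℝ e ((‖x - ζ‖ ^ (n + 2))⁻¹ • (x - ζ)) -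
      b * (1 - t ^ 2) / 2 * (‖x - ζ‖ ^ (n + 2))⁻¹ - 1 / (2 * b) * (‖x - ζ‖ ^ n)⁻¹) =ᵐ[ν] f := by
    filter_upwards [h] with ζ hζ
    have hpos : 0 < ‖x - ζ‖ := hδ.trans_le hζ
    have h4 : (‖x - ζ‖ ^ n)⁻¹ = ‖x - ζ‖ ^ 2 * (‖x - ζ‖ ^ (n + 2))⁻¹ := by
      field_simp
      ring
    simp only [hf]
    rw [← inner_sub_eq he hb, h4, inner_smul_right]
    ring
  have hfint : Integrable f ν :=
    (hFA.sub (hI.const_mul (1 / (2 * b)))).congr hae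
  have hlhs : inner ℝ e (rieszField ν (n + 2) x) -
      b * (1 - t ^ 2) / 2 * rieszPotential ν (n + 2) x - 1 / (2 * b) * rieszPotential ν n x =
      ∫ ζ, f ζ ∂ν := by
    rw [← integral_congr_ae hae, integral_sub hFA (hI.const_mul _),
      integral_sub hF (hA.const_mul _), integral_const_mul, integral_const_mul, rieszField,
      integral_inner (integrable_field hδ h (n + 1))]
    rfl
  have hnonpos : ∀ ζ, ζ ∉ S → f ζ ≤ 0 := by
    intro ζ hζ
    rw [hmemS, not_lt] at hζ
    have : (b * t) ^ 2 ≤ ‖x - ζ - b • e‖ ^ 2 := by gcongr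
    exact mul_nonpos_of_nonpos_of_nonneg
      (mul_nonpos_of_nonneg_of_nonpos (by positivity) (by linarith)) (by positivity)
  have hnonneg : ∀ ζ ∈ S, 0 ≤ f ζ := by
    intro ζ hζ
    rw [hmemS] at hζ
    have : ‖x - ζ - b • e‖ ^ 2 ≤ (b * t) ^ 2 := by gcongr
    have : 0 ≤ (b * t) ^ 2 - ‖x - ζ - b • e‖ ^ 2 := by linarith
    simp only [hf]
    positivity
  have hcont : ContinuousOn f (closedBall (x - b • e) (b * t)) := by
    intro ζ hζ
    rw [mem_closedBall_iff_norm', sub_right_comm] at hζ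
    have h1 : ‖b • e‖ ≤ ‖x - ζ‖ + ‖x - ζ - b • e‖ := by
      simpa using norm_sub_le (x - ζ) (x - ζ - b • e)
    rw [norm_smul, he, Real.norm_of_nonneg hb.le, mul_one] at h1
    have h2 : 0 < ‖x - ζ‖ := by nlinarith
    have hc : Continuous fun ζ => ‖x - ζ‖ ^ (n + 2) := by fun_prop
    exact (ContinuousAt.mul (by fun_prop)
      (hc.continuousAt.inv₀ (pow_ne_zero _ h2.ne'))).continuousWithinAt
  have hfvol : IntegrableOn f S :=
    (hcont.integrableOn_compact (isCompact_closedBall _ _)).mono_set ball_subset_closedBall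
  have hle : ∫ ζ, f ζ ∂ν ≤ ∫ ζ in S, f ζ := by
    calc ∫ ζ, f ζ ∂ν ≤ ∫ ζ, S.indicator f ζ ∂ν := by
          refine integral_mono hfint (hfint.indicator measurableSet_ball) fun ζ => ?_
          by_cases hζ : ζ ∈ S
          · simp [hζ]
          · simpa [hζ] using hnonpos ζ hζ
      _ = ∫ ζ in S, f ζ ∂ν := integral_indicator measurableSet_ball
      _ ≤ ∫ ζ in S, f ζ :=
          integral_mono_measure (Measure.restrict_mono subset_rfl hν)
            ((ae_restrict_mem measurableSet_ball).mono hnonneg) hfvol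
  have hchange : ∫ ζ in S, f ζ =
      1 / (2 * b) * ∫ z in ball 0 t, (t ^ 2 - ‖z‖ ^ 2) * (‖e + z‖ ^ (n + 2))⁻¹ := by
    rw [← integral_indicator measurableSet_ball, integral_affine_change _ x e hb,
      ← integral_indicator measurableSet_ball, ← integral_const_mul, ← integral_const_mul]
    refine integral_congr_ae (.of_forall fun z => ?_)
    have hz : x - (x - b • (e + z)) = b • (e + z) := by abel
    have hz' : b • (e + z) - b • e = b • z := by rw [smul_add]; abel
    have hiff : x - b • (e + z) ∈ S ↔ z ∈ ball (0 : EuclideanSpace ℝ (Fin n)) t := by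
      rw [hmemS, hz, hz', norm_smul, Real.norm_of_nonneg hb.le, mem_ball_zero_iff]
      exact mul_lt_mul_iff_right₀ hb
    change b ^ n * S.indicator f (x - b • (e + z)) = 1 / (2 * b) *
      (ball 0 t).indicator (fun z => (t ^ 2 - ‖z‖ ^ 2) * (‖e + z‖ ^ (n + 2))⁻¹) z
    by_cases hzt : z ∈ ball (0 : EuclideanSpace ℝ (Fin n)) t
    · rw [indicator_of_mem hzt, indicator_of_mem (hiff.2 hzt)]
      simp only [hf]
      rw [hz, hz', norm_smul, norm_smul, Real.norm_of_nonneg hb.le, mul_pow, mul_pow, mul_pow,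
        mul_inv]
      field_simp
      ring
    · rw [indicator_of_notMem hzt, indicator_of_notMem fun hc => hzt (hiff.1 hc), mul_zero, mul_zero]
  rw [hchange, ← hlhs] at hle
  linarith

theorem norm_rieszField_sq_le (hn : 0 < n) (hν : ν ≤ volume) (hδ : 0 < δ)
    (h : ∀ᵐ ζ ∂ν, δ ≤ ‖x - ζ‖) (ht0 : 0 ≤ t) (ht : t < 1)
    (hI : rieszPotential ν n x ≤ sphereArea n * ∫ s in Ioo 0 t, s ^ (n - 1) / (1 - s ^ 2)) :
    ‖rieszField ν (n + 2) x‖ ^ 2 ≤ sphereArea n / n * t ^ n * rieszPotential ν (n + 2) x := by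
  have hA : 0 ≤ rieszPotential ν (n + 2) x := integral_nonneg fun ζ => by positivity
  have hω := sphereArea_pos hn
  have ht2 : 0 < 1 - t ^ 2 := by nlinarith
  rcases eq_or_ne (rieszField ν (n + 2) x) 0 with h0 | h0
  · rw [h0]
    simp only [norm_zero, ne_eq, OfNat.ofNat_ne_zero, not_false_eq_true, zero_pow]
    positivity
  set F := rieszField ν (n + 2) x with hF
  set A := rieszPotential ν (n + 2) x with hAdef
  set e : EuclideanSpace ℝ (Fin n) := ‖F‖⁻¹ • F with hedef
  have he : ‖e‖ = 1 := norm_smul_inv_norm (𝕜 := ℝ) h0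
  have hFpos : 0 < ‖F‖ := norm_pos_iff.2 h0
  have heF : inner ℝ e F = ‖F‖ := by
    rw [hedef, real_inner_smul_left, real_inner_self_eq_norm_sq]
    field_simp
  have hext := setIntegral_ball_extremal hn he ht0 ht
  have hint : IntegrableOn (fun z => (t ^ 2 - ‖z‖ ^ 2) * (‖e + z‖ ^ (n + 2))⁻¹) (ball 0 t) :=
    integrableOn_ball_of_continuousOn (ContinuousOn.mul (by fun_prop)
      (continuousOn_inv_pow he ht _))
  rw [integral_add (integrableOn_ball_of_continuousOn (continuousOn_inv_pow he ht n)) hint,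
    setIntegral_ball_kernel hn he ht] at hext
  set Q := sphereArea n / n * (t ^ n / (1 - t ^ 2)) with hQ
  have hQ0 : 0 ≤ Q := by positivity
  have hall : ∀ b : ℝ, 0 ≤ (1 - t ^ 2) * A * (b * b) + (-(2 * ‖F‖)) * b + Q := by
    intro b
    rcases le_or_gt b 0 with hb | hb
    · have h1 : 0 ≤ (1 - t ^ 2) * A * (b * b) := mul_nonneg (by positivity) (mul_self_nonneg b)
      nlinarith
    · have h1 := inner_rieszField_le hν hδ h he hb ht0 ht
      rw [← hF, ← hAdef, heF] at h1
      have h2 : ‖F‖ ≤ b * (1 - t ^ 2) / 2 * A + 1 / (2 * b) * Q := by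
        refine h1.trans ?_
        gcongr
        linarith
      have h3 := mul_le_mul_of_nonneg_left h2 (by positivity : 0 ≤ 2 * b)
      have h4 : 2 * b * (b * (1 - t ^ 2) / 2 * A + 1 / (2 * b) * Q) =
          (1 - t ^ 2) * A * (b * b) + Q := by field_simp
      linarith
  have hd := discrim_le_zero hall
  rw [discrim] at hd
  have hPQ : (1 - t ^ 2) * A * Q = sphereArea n / n * t ^ n * A := by
    rw [hQ]
    field_simp
  nlinarith

/-- The differential inequality for the exponential transform. -/
theorem norm_rieszField_sq_mul_le (hn : 2 ≤ n) (hν : ν ≤ volume) (hδ : 0 < δ)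
    (h : ∀ᵐ ζ ∂ν, δ ≤ ‖x - ζ‖) (hI : 0 < rieszPotential ν n x) {E : ℝ}
    (hE : E = Real.exp (-(2 / sphereArea n * rieszPotential ν n x))) :
    ‖rieszField ν (n + 2) x‖ ^ 2 * (1 - (1 - 2 / (n : ℝ)) * E) ≤
      sphereArea n / n * (1 - E) * rieszPotential ν (n + 2) x := by
  have hn0 : 0 < n := by omega
  have hω := sphereArea_pos hn0
  have hn2 : (2 : ℝ) ≤ n := by exact_mod_cast hn
  have hα0 : 0 ≤ 1 - 2 / (n : ℝ) := by
    rw [sub_nonneg, div_le_one (by linarith)]; exact hn2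
  have hα1 : 0 < 1 - (1 - 2 / (n : ℝ)) := by
    have : (0 : ℝ) < 2 / n := by positivity
    linarith
  set α : ℝ := 1 - 2 / (n : ℝ) with hα
  have hE0 : 0 < E := hE ▸ Real.exp_pos _
  have hE1 : E < 1 := by
    rw [hE, Real.exp_lt_one_iff, neg_lt_zero]
    positivity
  have hden : 0 < 1 - α * E := by nlinarith
  set q : ℝ := (1 - E) / (1 - α * E) with hq
  have hqD : q * (1 - α * E) = 1 - E := div_mul_cancel₀ _ hden.ne'
  have hq0 : 0 ≤ q := div_nonneg (by linarith) hden.le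
  have hq1 : q < 1 := by rw [hq, div_lt_one hden]; nlinarith
  set t : ℝ := q ^ ((n : ℝ)⁻¹) with ht
  have htn : t ^ n = q := Real.rpow_inv_natCast_pow hq0 (by omega)
  have ht0 : 0 ≤ t := Real.rpow_nonneg hq0 _
  have ht1 : t < 1 := Real.rpow_lt_one hq0 hq1 (by positivity)
  have hlog := log_le_setIntegral hn ht0 ht1
  rw [htn, ← hα] at hlog
  have hratio : (1 - α * q) / (1 - q) = Real.exp (2 / sphereArea n * rieszPotential ν n x) := by
    have h1 : (1 - α * q) / (1 - q) = E⁻¹ := by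
      have h2 : 1 - q = (1 - α) * E / (1 - α * E) := by
        rw [eq_div_iff hden.ne']
        linear_combination -hqD
      have h3 : 1 - α * q = (1 - α) / (1 - α * E) := by
        rw [eq_div_iff hden.ne']
        linear_combination -α * hqD
      rw [h2, h3]
      field_simp
    rw [h1, hE, Real.exp_neg, inv_inv]
  rw [hratio, Real.log_exp] at hlog
  have hI' : rieszPotential ν n x ≤ sphereArea n * ∫ s in Ioo 0 t, s ^ (n - 1) / (1 - s ^ 2) := by
    have h3 := mul_le_mul_of_nonneg_left hlog (by positivity : 0 ≤ sphereArea n / 2)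
    have h4 : sphereArea n / 2 * (2 / sphereArea n * rieszPotential ν n x) =
      rieszPotential ν n x := by field_simp
    linarith
  have hmain := norm_rieszField_sq_le hn0 hν hδ h ht0 ht1 hI'
  rw [htn] at hmain
  have h5 := mul_le_mul_of_nonneg_right hmain hden.le
  have h6 : sphereArea n / n * q * rieszPotential ν (n + 2) x * (1 - α * E) =
      sphereArea n / n * (1 - E) * rieszPotential ν (n + 2) x := by
    linear_combination sphereArea n / n * rieszPotential ν (n + 2) x * hqD
  linarith

end

/-- The measure with density `ρ`. -/
def densityMeasure (ρ : EuclideanSpace ℝ (Fin n) → ℝ) : Measure (EuclideanSpace ℝ (Fin n)) :=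
  volume.withDensity fun x => ENNReal.ofReal (ρ x)

section Density

variable {ρ : EuclideanSpace ℝ (Fin n) → ℝ} {x : EuclideanSpace ℝ (Fin n)}

theorem IsDensity.densityMeasure_le (hρ : IsDensity ρ) : densityMeasure ρ ≤ volume := by
  calc densityMeasure ρ ≤ volume.withDensity 1 := by
        refine withDensity_mono ?_
        filter_upwards [hρ.le_one] with y hy
        simpa using hy
    _ = volume := withDensity_one

theorem IsDensity.isFiniteMeasure (hρ : IsDensity ρ) : IsFiniteMeasure (densityMeasure ρ) := by
  refine ⟨?_⟩
  have h0 : densityMeasure ρ (densitySupport ρ)ᶜ = 0 := Measure.measure_compl_support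
  calc densityMeasure ρ univ
      ≤ densityMeasure ρ (densitySupport ρ) + densityMeasure ρ (densitySupport ρ)ᶜ := by
        rw [← union_compl_self (densitySupport ρ)]
        exact measure_union_le _ _
    _ = densityMeasure ρ (densitySupport ρ) := by rw [h0, add_zero]
    _ ≤ volume (densitySupport ρ) := hρ.densityMeasure_le _
    _ < ⊤ := hρ.isCompact_support.measure_lt_top

theorem exists_far_of_notMem_support (hx : x ∈ (densitySupport ρ)ᶜ) :
    ∃ δ > 0, ∀ᵐ ζ ∂densityMeasure ρ, δ ≤ ‖x - ζ‖ := by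
  obtain ⟨U, hU, hU0⟩ := Measure.notMem_support_iff_exists.1 hx
  obtain ⟨δ, hδ, hball⟩ := Metric.mem_nhds_iff.1 hU
  refine ⟨δ, hδ, ?_⟩
  have : ∀ᵐ ζ ∂densityMeasure ρ, ζ ∉ U := measure_eq_zero_iff_ae_notMem.1 hU0
  filter_upwards [this] with ζ hζ
  by_contra! hlt
  exact hζ (hball (mem_ball_iff_norm'.2 hlt))

theorem IsDensity.expTransform_eq (hρ : IsDensity ρ) (hx : x ∈ (densitySupport ρ)ᶜ) :
    expTransform ρ x =
      Real.exp (-(2 / sphereArea n * rieszPotential (densityMeasure ρ) n x)) := by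
  have := hρ.isFiniteMeasure
  obtain ⟨δ, hδ, hfar⟩ := exists_far_of_notMem_support hx
  have hm : AEMeasurable (fun x => ENNReal.ofReal (ρ x)) volume := hρ.aemeasurable.ennreal_ofReal
  have hae : (fun ζ => (ENNReal.ofReal (ρ ζ)).toReal • (‖x - ζ‖ ^ n)⁻¹) =ᵐ[volume]
      fun ζ => ρ ζ / ‖x - ζ‖ ^ n := by
    filter_upwards [hρ.nonneg] with ζ hζ
    rw [ENNReal.toReal_ofReal hζ, smul_eq_mul, div_eq_mul_inv]
  have hint : Integrable (fun ζ => ρ ζ / ‖x - ζ‖ ^ n) volume := by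
    refine Integrable.congr ?_ hae
    exact (integrable_withDensity_iff_integrable_smul₀' hm (by simp)).1
      (integrable_kernel hδ hfar n)
  have hpot : rieszPotential (densityMeasure ρ) n x = ∫ ζ, ρ ζ / ‖x - ζ‖ ^ n := by
    rw [rieszPotential, densityMeasure,
      integral_withDensity_eq_integral_toReal_smul₀ hm (by simp), integral_congr_ae hae]
  rw [expTransform, if_pos hint, hpot, neg_mul]

theorem IsDensity.rieszPotential_pos (hρ : IsDensity ρ) (hρ0 : ¬ (∀ᵐ x, ρ x = 0)) (m : ℕ)
    (hx : x ∈ (densitySupport ρ)ᶜ) : 0 < rieszPotential (densityMeasure ρ) m x := by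
  have := hρ.isFiniteMeasure
  obtain ⟨δ, hδ, hfar⟩ := exists_far_of_notMem_support hx
  have hm : AEMeasurable (fun x => ENNReal.ofReal (ρ x)) volume := hρ.aemeasurable.ennreal_ofReal
  refine (integral_nonneg fun ζ => by positivity).lt_of_ne' fun h0 => hρ0 ?_
  rw [integral_eq_zero_iff_of_nonneg (fun ζ => by positivity) (integrable_kernel hδ hfar m)] at h0
  have hfalse : ∀ᵐ ζ ∂densityMeasure ρ, False := by
    filter_upwards [h0, hfar] with ζ h1 h2
    have h3 : 0 < ‖x - ζ‖ := hδ.trans_le h2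
    exact (inv_pos.2 (pow_pos h3 m)).ne' h1
  have hzero : densityMeasure ρ = 0 := by
    rwa [eventually_false_iff_eq_bot, ae_eq_bot] at hfalse
  rw [densityMeasure, withDensity_eq_zero_iff hm] at hzero
  filter_upwards [hzero, hρ.nonneg] with ζ h1 h2
  exact le_antisymm (ENNReal.ofReal_eq_zero.1 h1) h2

end Density

theorem SubharmonicOn.congr {u v : EuclideanSpace ℝ (Fin n) → ℝ}
    {Ω : Set (EuclideanSpace ℝ (Fin n))} (hu : SubharmonicOn u Ω) (huv : EqOn u v Ω) :
    SubharmonicOn v Ω := by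
  refine ⟨fun x hx y hy => ?_, fun K hK hKΩ h hh hharm hle x hx => ?_⟩
  · filter_upwards [hu.1 x hx y ((huv hx).trans_lt hy), self_mem_nhdsWithin] with z hz hzΩ
    exact (huv hzΩ).symm.trans_lt hz
  · rw [← huv (hKΩ hx)]
    refine hu.2 K hK hKΩ h hh hharm (fun z hz => ?_) x hx
    rw [huv (hKΩ (hK.isClosed.frontier_subset hz))]
    exact hle z hz

theorem hasDerivAt_one_sub_exp_neg (v : ℝ) :
    HasDerivAt (fun v : ℝ => 1 - Real.exp (-v)) (Real.exp (-v)) v := by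
  simpa using ((hasDerivAt_neg v).exp).const_sub 1

theorem one_sub_exp_neg_pos {v : ℝ} (hv : 0 < v) : 0 < 1 - Real.exp (-v) := by
  rw [sub_pos, Real.exp_lt_one_iff]
  linarith

/-- A function of the potential whose derivative is `κ (1 - e⁻ᵛ) ^ (-2/n) e⁻ᵛ` is subharmonic off
the support. -/
theorem subharmonicOn_comp_rieszPotential (hn : 2 ≤ n) {ρ : EuclideanSpace ℝ (Fin n) → ℝ}
    (hρ : IsDensity ρ) (hρ0 : ¬ (∀ᵐ x, ρ x = 0)) {G : ℝ → ℝ} {κ : ℝ} (hκ : 0 ≤ κ)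
    (hG : ∀ v > 0, HasDerivAt G
      (κ * ((1 - Real.exp (-v)) ^ (-(2 / (n : ℝ))) * Real.exp (-v))) v) :
    SubharmonicOn
      (fun x => G (2 / sphereArea n * rieszPotential (densityMeasure ρ) n x))
      (densitySupport ρ)ᶜ := by
  have hn0 : 0 < n := by omega
  have hω := sphereArea_pos hn0
  have := hρ.isFiniteMeasure
  have hpos : ∀ x ∈ (densitySupport ρ)ᶜ,
      0 < 2 / sphereArea n * rieszPotential (densityMeasure ρ) n x := fun x hx =>
    mul_pos (by positivity) (hρ.rieszPotential_pos hρ0 n hx)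
  refine subharmonicOn_of_sum_deriv2_nonneg hn0 (fun x hx => ?_) fun x hx => ?_
  · obtain ⟨δ, hδ, hfar⟩ := exists_far_of_notMem_support hx
    exact (ContinuousAt.comp (f := fun x => 2 / sphereArea n *
      rieszPotential (densityMeasure ρ) n x) (hG _ (hpos x hx)).continuousAt
      (continuousAt_const.mul (continuousAt_rieszPotential hδ hfar n))).continuousWithinAt
  obtain ⟨δ, hδ, hfar⟩ := exists_far_of_notMem_support hx
  have hI := hρ.rieszPotential_pos hρ0 n hx
  have hv := hpos x hx
  have hineq := norm_rieszField_sq_mul_le hn hρ.densityMeasure_le hδ hfar hI rfl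
  set ν := densityMeasure ρ with hν
  set v := 2 / sphereArea n * rieszPotential ν n x with hvdef
  set E := Real.exp (-v) with hE
  have hW : 0 < 1 - E := one_sub_exp_neg_pos hv
  have hG' : HasDerivAt
      (fun v : ℝ => κ * ((1 - Real.exp (-v)) ^ (-(2 / (n : ℝ))) * Real.exp (-v)))
      (κ * ((1 - E) ^ (-(2 / (n : ℝ)) - 1) * E * (-(2 / n * E) - (1 - E)))) v := by
    have h1 := (hasDerivAt_one_sub_exp_neg v).rpow_const (p := -(2 / (n : ℝ))) (.inl hW.ne')
    have h2 : HasDerivAt (fun v : ℝ => Real.exp (-v)) (-E) v := by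
      simpa using (hasDerivAt_neg v).exp
    refine ((h1.mul h2).const_mul κ).congr_deriv ?_
    have h3 : (1 - E) ^ (-(2 / (n : ℝ))) = (1 - E) ^ (-(2 / (n : ℝ)) - 1) * (1 - E) := by
      rw [Real.rpow_sub_one hW.ne', div_mul_cancel₀ _ hW.ne']
    simp only [← hE]
    rw [h3]
    ring
  refine ⟨_, _, fun i => HasDeriv2At.comp (G := G)
    (φ := fun s => 2 / sphereArea n * rieszPotential ν n (x + s • stdVec i))
    (c := κ * ((1 - E) ^ (-(2 / (n : ℝ)) - 1) * E * (-(2 / n * E) - (1 - E))))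
    (G' := fun v => κ * ((1 - Real.exp (-v)) ^ (-(2 / (n : ℝ))) * Real.exp (-v)))
    ?_ ?_ ((hasDeriv2At_rieszPotential hδ hfar n (by simp)).const_mul _), ?_⟩
  · simp only [zero_smul, add_zero]
    filter_upwards [lt_mem_nhds hv] with w hw using hG w hw
  · simpa only [zero_smul, add_zero] using hG'
  · simp only [zero_smul, add_zero, integral_kernel_deriv_eq hδ hfar]
    rw [Finset.sum_add_distrib, ← Finset.mul_sum, ← Finset.mul_sum, ← Finset.mul_sum,
      sum_integral_kernel_deriv2 hδ hfar]
    set F := rieszField ν (n + 2) x with hF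
    set A := rieszPotential ν (n + 2) x with hA
    have hsum : ∑ i, (2 / sphereArea n * -((n : ℝ) * inner ℝ (stdVec i) F)) ^ 2 =
        (2 / sphereArea n * n) ^ 2 * ‖F‖ ^ 2 := by
      rw [← sum_inner_stdVec_sq, Finset.mul_sum]
      refine Finset.sum_congr rfl fun i _ => ?_
      rw [real_inner_comm]
      ring
    rw [hsum, ← hvdef, ← hE]
    have h3 : (1 - E) ^ (-(2 / (n : ℝ))) = (1 - E) ^ (-(2 / (n : ℝ)) - 1) * (1 - E) := by
      rw [Real.rpow_sub_one hW.ne', div_mul_cancel₀ _ hW.ne']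
    rw [h3]
    have hR : 0 ≤ (1 - E) ^ (-(2 / (n : ℝ)) - 1) := Real.rpow_nonneg hW.le _
    have hE0 : 0 ≤ E := (Real.exp_pos _).le
    have hfac : κ * ((1 - E) ^ (-(2 / (n : ℝ)) - 1) * E * (-(2 / n * E) - (1 - E))) *
        ((2 / sphereArea n * n) ^ 2 * ‖F‖ ^ 2) +
        κ * ((1 - E) ^ (-(2 / (n : ℝ)) - 1) * (1 - E) * E) *
          (2 / sphereArea n * (n * (n + 2 - n) * A)) =
        κ * (1 - E) ^ (-(2 / (n : ℝ)) - 1) * E * ((2 / sphereArea n * n) ^ 2 *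
          (sphereArea n / n * (1 - E) * A - ‖F‖ ^ 2 * (1 - (1 - 2 / (n : ℝ)) * E))) := by
      field_simp
      ring
    rw [hfac]
    have : 0 ≤ sphereArea n / n * (1 - E) * A - ‖F‖ ^ 2 * (1 - (1 - 2 / (n : ℝ)) * E) :=
      sub_nonneg.2 hineq
    positivity

end ExpTransform

end

theorem theorem1p1 (n : ℕ) (ρ : EuclideanSpace ℝ (Fin n) → ℝ)
    (hρ : ExpTransform.IsDensity ρ) (hρ0 : ¬ (∀ᵐ x, ρ x = 0)) :
    (n = 2 →
      ExpTransform.SubharmonicOn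
        (fun x => Real.log (1 - ExpTransform.expTransform ρ x))
        (ExpTransform.densitySupport ρ)ᶜ) ∧
    (3 ≤ n →
      ExpTransform.SubharmonicOn
        (fun x => 1 / ((n : ℝ) - 2) *
          (1 - ExpTransform.expTransform ρ x) ^ (((n : ℝ) - 2) / (n : ℝ)))
        (ExpTransform.densitySupport ρ)ᶜ) := by
  refine ⟨fun hn => ?_, fun hn => ?_⟩
  · refine (ExpTransform.subharmonicOn_comp_rieszPotential hn.ge hρ hρ0
      (G := fun v => Real.log (1 - Real.exp (-v))) zero_le_one fun v hv => ?_).congr fun x hx => ?_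
    · have hW := ExpTransform.one_sub_exp_neg_pos hv
      refine ((ExpTransform.hasDerivAt_one_sub_exp_neg v).log hW.ne').congr_deriv ?_
      rw [hn, Nat.cast_ofNat, div_self two_ne_zero, Real.rpow_neg_one]
      field_simp
    · simp only [hρ.expTransform_eq hx]
  · have hn3 : (3 : ℝ) ≤ n := by exact_mod_cast hn
    have hn2 : (n : ℝ) - 2 ≠ 0 := by linarith
    refine (ExpTransform.subharmonicOn_comp_rieszPotential (by omega) hρ hρ0
      (G := fun v => 1 / ((n : ℝ) - 2) * (1 - Real.exp (-v)) ^ (((n : ℝ) - 2) / (n : ℝ)))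
      (κ := 1 / n) (by positivity) fun v hv => ?_).congr fun x hx => ?_
    · have hW := ExpTransform.one_sub_exp_neg_pos hv
      refine (((ExpTransform.hasDerivAt_one_sub_exp_neg v).rpow_const (p := ((n : ℝ) - 2) / n)
        (.inl hW.ne')).const_mul (1 / ((n : ℝ) - 2))).congr_deriv ?_
      have hexp : ((n : ℝ) - 2) / n - 1 = -(2 / n) := by
        field_simp
        ring
      rw [hexp]
      field_simp
    · simp only [hρ.expTransform_eq hx]
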